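/- Let $\mathcal T_h^3$ be a conforming tetrahedral mesh (a finite simplicial complex in $\mathbb R^3$ in which every simplex is a face of a tetrahedron), let $\overline{\Omega}$ be the union of its closed tetrahedra $t\in\mathcal T$ and $\Omega$ the interior of that union, and let $\mathcal V$, $\mathcal E$ be its sets of vertices and edges. Let $p\ge 0$ be an integer; $\mathcal P_k(t)$ denotes the polynomials of degree at most $k$ on $t$, with $\mathcal P_k(t)=\{0\}$ for $k<0$. Put $$\mathcal P_{2,p}\Lambda^1(\mathcal T_h^3)=\{\boldsymbol w\in H(\mathrm{curl};\Omega):\ \boldsymbol w|_t\in \mathcal P_p(t)^3\ \ \forall t\in\mathcal T,\ \boldsymbol w\in C^1(\mathcal V),\ \boldsymbol w\in C^0(\mathcal E)\},$$ where $C^1(\mathcal V)$ means that at each vertex all elements containing it give the same values and the same first order partial derivatives, and $C^0(\mathcal E)$ means that on each edge all elements containing it give the same values. Let $\boldsymbol S_h^p$ be the vector Hermite space, i.e. the space of vector fields each of whose three components belongs to $$\{s\in H^1(\Omega)\cap C^0(\overline\Omega):\ s|_t\in\mathcal P_p(t)\ \ \forall t\in\mathcal T,\ s\in C^1(\mathcal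 V)\}.$$ For a tetrahedron $t\in\mathcal T$ with vertices numbered $0,\dots,3$, barycentric coordinates $\lambda_0,\dots,\lambda_3$ and unit normals $\boldsymbol\nu_i$ of the faces opposite to the vertices $i$, put $$\Sigma^c_{t,p}=\sum_{i=0}^3\mathcal P_{p-3}(t)\,\lambda_j\lambda_l\lambda_m\,\boldsymbol\nu_i,\qquad \{i,j,l,m\}=\{0,1,2,3\},$$ and let $\Sigma_p^c=\{\boldsymbol w\in L^2(\Omega)^3:\ \boldsymbol w|_t\in\Sigma^c_{t,p}\ \ \forall t\in\mathcal T\}$. Then, as subspaces of $L^2(\Omega)^3$, $$\mathcal P_{2,p}\Lambda^1(\mathcal T_h^3)=\boldsymbol S_h^p+\Sigma_p^c,$$ and for every $t\in\mathcal T$ the space of restrictions $\{\boldsymbol w|_t:\boldsymbol w\in\Sigma_p^c\}$ is equal to $\Sigma^c_{t,p}$. -/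

import Mathlib

open MeasureTheory
open scoped ContDiff

noncomputable section

/-- Euclidean three-space. -/
abbrev E3 : Type := EuclideanSpace ℝ (Fin 3)

namespace HCurlFE

/-! ### Differential operators on test functions -/

/-- The classical partial derivative `∂ᵢ φ`. -/
def pd (i : Fin 3) (φ : E3 → ℝ) (x : E3) : ℝ :=
  fderiv ℝ φ x (EuclideanSpace.single i 1)

/-- The classical curl of a vector field. -/
def curl (φ : E3 → E3) (x : E3) : E3 :=
  !₂[pd 1 (fun y => φ y 2) x - pd 2 (fun y => φ y 1) x,
     pd 2 (fun y => φ y 0) x - pd 0 (fun y => φ y 2) x,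
     pd 0 (fun y => φ y 1) x - pd 1 (fun y => φ y 0) x]

/-- Test functions on an open set `Ω`: smooth with compact support in `Ω`. -/
def IsTest {F : Type*} [NormedAddCommGroup F] [NormedSpace ℝ F] (Ω : Set E3) (φ : E3 → F) :
    Prop :=
  ContDiff ℝ ∞ φ ∧ HasCompactSupport φ ∧ tsupport φ ⊆ Ω

/-- Scalar `L²(Ω)`. -/
abbrev L2s (Ω : Set E3) := Lp ℝ 2 (volume.restrict Ω)

/-- Vector-valued `L²(Ω; ℝ³)`. -/
abbrev L2v (Ω : Set E3) := Lp E3 2 (volume.restrict Ω)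

/-- `g` is the weak partial derivative `∂ᵢ s` on `Ω`. -/
def HasWeakPartial (Ω : Set E3) (i : Fin 3) (s g : L2s Ω) : Prop :=
  ∀ φ : E3 → ℝ, IsTest Ω φ → ∫ x in Ω, s x * pd i φ x = - ∫ x in Ω, g x * φ x

/-- `g` is the weak curl of `w` on `Ω`. -/
def HasWeakCurl (Ω : Set E3) (w g : L2v Ω) : Prop :=
  ∀ φ : E3 → E3, IsTest Ω φ → ∫ x in Ω, inner ℝ (w x) (curl φ x) = ∫ x in Ω, inner ℝ (g x) (φ x)

theorem integrable_mul_test {Ω : Set E3} (s : L2s Ω) {ψ : E3 → ℝ} (hc : Continuous ψ)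
    (hs : HasCompactSupport ψ) : Integrable (fun x => s x * ψ x) (volume.restrict Ω) :=
  MemLp.integrable_mul (p := 2) (q := 2) (Lp.memLp s) (hc.memLp_of_hasCompactSupport hs)

theorem integrable_inner_test {Ω : Set E3} (w : L2v Ω) {ψ : E3 → E3} (hc : Continuous ψ)
    (hs : HasCompactSupport ψ) : Integrable (fun x => inner ℝ (w x) (ψ x)) (volume.restrict Ω) := by
  have hψ : MemLp ψ 2 (volume.restrict Ω) := hc.memLp_of_hasCompactSupport hs
  refine (L2.integrable_inner (𝕜 := ℝ) w hψ.toLp).congr ?_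
  filter_upwards [hψ.coeFn_toLp] with x hx
  rw [hx]

theorem continuous_pd {φ : E3 → ℝ} (h : ContDiff ℝ ∞ φ) (i : Fin 3) : Continuous (pd i φ) :=
  (h.continuous_fderiv (by simp)).clm_apply continuous_const

theorem compactSupport_pd {φ : E3 → ℝ} (h : HasCompactSupport φ) (i : Fin 3) :
    HasCompactSupport (pd i φ) :=
  h.fderiv_apply ℝ (EuclideanSpace.single i 1)

theorem contDiff_coord {φ : E3 → E3} (h : ContDiff ℝ ∞ φ) (i : Fin 3) :
    ContDiff ℝ ∞ (fun y => φ y i) :=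
  (contDiff_euclidean.1 h) i

theorem continuous_curl {φ : E3 → E3} (h : ContDiff ℝ ∞ φ) : Continuous (curl φ) := by
  have H := fun i j => continuous_pd (contDiff_coord h j) i
  refine (PiLp.continuous_toLp 2 _).comp (continuous_pi fun k => ?_)
  fin_cases k
  · exact (H 1 2).sub (H 2 1)
  · exact (H 2 0).sub (H 0 2)
  · exact (H 0 1).sub (H 1 0)

theorem compactSupport_curl {φ : E3 → E3} (h : HasCompactSupport φ) :
    HasCompactSupport (curl φ) := by
  have h0 : ∀ x, x ∉ tsupport φ → ∀ i j, pd i (fun y => φ y j) x = 0 := by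
    intro x hx i j
    have : (fun y => φ y j) =ᶠ[nhds x] fun _ => (0 : ℝ) := by
      filter_upwards [notMem_tsupport_iff_eventuallyEq.1 hx] with y hy
      simp [hy]
    simp [pd, this.fderiv_eq]
  refine HasCompactSupport.intro h fun x hx => ?_
  ext k
  fin_cases k <;> simp [curl, h0 x hx]

/-- The Sobolev space `H¹(Ω)`. -/
def H1 (Ω : Set E3) : Submodule ℝ (L2s Ω) where
  carrier := {s | ∀ i, ∃ g, HasWeakPartial Ω i s g}
  zero_mem' := fun i => ⟨0, fun φ _ => by
    have h : ∀ ψ : E3 → ℝ, ∫ x in Ω, (0 : L2s Ω) x * ψ x = 0 := fun ψ =>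
      integral_eq_zero_of_ae <| by
        filter_upwards [Lp.coeFn_zero ℝ 2 (volume.restrict Ω)] with x hx
        simp only [hx, Pi.zero_apply, zero_mul]
    exact (h _).trans (by rw [h, neg_zero])⟩
  add_mem' := by
    intro s t hs ht i
    obtain ⟨g, hg⟩ := hs i
    obtain ⟨k, hk⟩ := ht i
    refine ⟨g + k, fun φ hφ => ?_⟩
    have i1 := fun u : L2s Ω => integrable_mul_test u (continuous_pd hφ.1 i)
      (compactSupport_pd hφ.2.1 i)
    have i2 := fun u : L2s Ω => integrable_mul_test u hφ.1.continuous hφ.2.1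
    calc ∫ x in Ω, (s + t : L2s Ω) x * pd i φ x
        = ∫ x in Ω, (s x * pd i φ x + t x * pd i φ x) := by
          refine integral_congr_ae ?_
          filter_upwards [Lp.coeFn_add s t] with x hx
          rw [hx, Pi.add_apply, add_mul]
      _ = - ∫ x in Ω, (g x * φ x + k x * φ x) := by
          rw [integral_add (i1 s) (i1 t), integral_add (i2 g) (i2 k), hg φ hφ, hk φ hφ, neg_add]
      _ = - ∫ x in Ω, (g + k : L2s Ω) x * φ x := by
          congr 1
          refine integral_congr_ae ?_
          filter_upwards [Lp.coeFn_add g k] with x hx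
          rw [hx, Pi.add_apply, add_mul]
  smul_mem' := by
    intro c s hs i
    obtain ⟨g, hg⟩ := hs i
    refine ⟨c • g, fun φ hφ => ?_⟩
    calc ∫ x in Ω, (c • s : L2s Ω) x * pd i φ x
        = ∫ x in Ω, c * (s x * pd i φ x) := by
          refine integral_congr_ae ?_
          filter_upwards [Lp.coeFn_smul c s] with x hx
          rw [hx, Pi.smul_apply, smul_eq_mul, mul_assoc]
      _ = - ∫ x in Ω, c * (g x * φ x) := by
          rw [integral_const_mul, integral_const_mul, hg φ hφ, mul_neg]
      _ = - ∫ x in Ω, (c • g : L2s Ω) x * φ x := by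
          congr 1
          refine integral_congr_ae ?_
          filter_upwards [Lp.coeFn_smul c g] with x hx
          rw [hx, Pi.smul_apply, smul_eq_mul, mul_assoc]

/-- The space `H(curl; Ω)`. -/
def Hcurl (Ω : Set E3) : Submodule ℝ (L2v Ω) where
  carrier := {w | ∃ g, HasWeakCurl Ω w g}
  zero_mem' := ⟨0, fun φ _ => by
    have h : ∀ ψ : E3 → E3, ∫ x in Ω, inner ℝ ((0 : L2v Ω) x) (ψ x) = 0 := fun ψ =>
      integral_eq_zero_of_ae <| by
        filter_upwards [Lp.coeFn_zero E3 2 (volume.restrict Ω)] with x hx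
        rw [hx, Pi.zero_apply, inner_zero_left, Pi.zero_apply]
    exact (h _).trans (h _).symm⟩
  add_mem' := by
    rintro w v ⟨g, hg⟩ ⟨k, hk⟩
    refine ⟨g + k, fun φ hφ => ?_⟩
    have i1 := fun u : L2v Ω => integrable_inner_test u (continuous_curl hφ.1)
      (compactSupport_curl hφ.2.1)
    have i2 := fun u : L2v Ω => integrable_inner_test u hφ.1.continuous hφ.2.1
    calc ∫ x in Ω, inner ℝ ((w + v : L2v Ω) x) (curl φ x)
        = ∫ x in Ω, (inner ℝ (w x) (curl φ x) + inner ℝ (v x) (curl φ x)) := by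
          refine integral_congr_ae ?_
          filter_upwards [Lp.coeFn_add w v] with x hx
          rw [hx, Pi.add_apply, inner_add_left]
      _ = ∫ x in Ω, (inner ℝ (g x) (φ x) + inner ℝ (k x) (φ x)) := by
          rw [integral_add (i1 w) (i1 v), integral_add (i2 g) (i2 k), hg φ hφ, hk φ hφ]
      _ = ∫ x in Ω, inner ℝ ((g + k : L2v Ω) x) (φ x) := by
          refine integral_congr_ae ?_
          filter_upwards [Lp.coeFn_add g k] with x hx
          rw [hx, Pi.add_apply, inner_add_left]
  smul_mem' := by
    rintro c w ⟨g, hg⟩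
    refine ⟨c • g, fun φ hφ => ?_⟩
    calc ∫ x in Ω, inner ℝ ((c • w : L2v Ω) x) (curl φ x)
        = ∫ x in Ω, c * inner ℝ (w x) (curl φ x) := by
          refine integral_congr_ae ?_
          filter_upwards [Lp.coeFn_smul c w] with x hx
          rw [hx, Pi.smul_apply, real_inner_smul_left]
      _ = ∫ x in Ω, c * inner ℝ (g x) (φ x) := by
          rw [integral_const_mul, integral_const_mul, hg φ hφ]
      _ = ∫ x in Ω, inner ℝ ((c • g : L2v Ω) x) (φ x) := by
          refine integral_congr_ae ?_
          filter_upwards [Lp.coeFn_smul c g] with x hx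
          rw [hx, Pi.smul_apply, real_inner_smul_left]

/-! ### Polynomials -/

/-- Polynomials in three real variables. -/
abbrev Poly := MvPolynomial (Fin 3) ℝ

/-- The value of a polynomial at a point of `ℝ³`. -/
def ev (q : Poly) (x : E3) : ℝ := MvPolynomial.eval (fun i => x i) q

/-- The value of a polynomial vector field at a point of `ℝ³`. -/
def evv (q : Fin 3 → Poly) (x : E3) : E3 := WithLp.toLp 2 fun i => ev (q i) x

theorem ev_zero (x : E3) : ev 0 x = 0 := by simp [ev]

theorem ev_add (q r : Poly) (x : E3) : ev (q + r) x = ev q x + ev r x := by simp [ev]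

theorem ev_smul (c : ℝ) (q : Poly) (x : E3) : ev (c • q) x = c * ev q x := by simp [ev]

theorem evv_zero (x : E3) : evv 0 x = 0 := by
  ext i; simp [evv, ev_zero]

theorem evv_add (q r : Fin 3 → Poly) (x : E3) : evv (q + r) x = evv q x + evv r x := by
  ext i; simp [evv, ev_add]

theorem evv_smul (c : ℝ) (q : Fin 3 → Poly) (x : E3) : evv (c • q) x = c • evv q x := by
  ext i; simp [evv, ev_smul]

/-- Two polynomials have the same value and the same first order partial derivatives at `x`. -/
def AgreeC1 (q r : Poly) (x : E3) : Prop :=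
  ev q x = ev r x ∧ ∀ j, ev (MvPolynomial.pderiv j q) x = ev (MvPolynomial.pderiv j r) x

theorem AgreeC1.add {q r q' r' : Poly} {x : E3} (h : AgreeC1 q r x) (h' : AgreeC1 q' r' x) :
    AgreeC1 (q + q') (r + r') x :=
  ⟨by rw [ev_add, ev_add, h.1, h'.1],
    fun j => by rw [map_add, map_add, ev_add, ev_add, h.2 j, h'.2 j]⟩

theorem AgreeC1.smul {q r : Poly} {x : E3} (c : ℝ) (h : AgreeC1 q r x) :
    AgreeC1 (c • q) (c • r) x :=
  ⟨by rw [ev_smul, ev_smul, h.1],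
    fun j => by rw [Derivation.map_smul, Derivation.map_smul, ev_smul, ev_smul, h.2 j]⟩

end HCurlFE

open HCurlFE

/-! ### Meshes -/

/-- A conforming tetrahedral mesh: a finite simplicial complex in `ℝ³`, each of whose simplices is
a face of a tetrahedron of the complex. -/
structure TetMesh extends Geometry.SimplicialComplex ℝ E3 where
  finite : faces.Finite
  pure : ∀ s ∈ faces, ∃ t ∈ faces, s ⊆ t ∧ t.card = 4

namespace TetMesh

variable (M : TetMesh)

/-- The union of all (closed) tetrahedra of the mesh. -/
def closedDomain : Set E3 := M.toSimplicialComplex.space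

/-- The open polyhedral domain `Ω` that is triangulated by the mesh. -/
def domain : Set E3 := interior M.closedDomain

/-- The tetrahedra (3D cells) of the mesh, each given by its set of four vertices. -/
def Cell : Type := {t : Finset E3 // t ∈ M.faces ∧ t.card = 4}

variable {M}

/-- The closed tetrahedron. -/
def Cell.body (t : M.Cell) : Set E3 := convexHull ℝ (t.1 : Set E3)

/-- The four vertices of a cell as an affine basis of `ℝ³`. -/
def Cell.basis (t : M.Cell) : AffineBasis t.1 ℝ E3 where
  toFun := (↑)
  ind' := M.indep t.2.1
  tot' := (M.indep t.2.1).affineSpan_eq_top_iff_card_eq_finrank_add_one.2 (by simp [t.2.2])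

/-- The barycentric coordinate `λ_v` of the cell belonging to its vertex `v`. -/
def Cell.bary (t : M.Cell) (v : t.1) (x : E3) : ℝ := t.basis.coord v x

/-- `ν` is a unit normal vector of the face of the cell that lies opposite to the vertex `v`. -/
def Cell.IsUnitNormal (t : M.Cell) (v : t.1) (ν : E3) : Prop :=
  ‖ν‖ = 1 ∧ ∀ a b : t.1, a ≠ v → b ≠ v → inner ℝ ν ((a : E3) - (b : E3)) = 0

open Classical in
/-- The local `H(curl)` bubble space `Σ_{t,p} = ∑_v P_{p-3} λ_a λ_b λ_c ν_v`, where `a, b, c` are the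
vertices of `t` other than `v` and `ν_v` is the normal of the face spanned by `a, b, c`. The degree
condition `deg q + 3 ≤ p` gives the zero space for `p < 3`; as the two unit normals of a face differ
by a sign, using both of them does not change the span. -/
def Cell.bubble (t : M.Cell) (p : ℕ) : Submodule ℝ (E3 → E3) :=
  ⨆ v : t.1, Submodule.span ℝ
    {f | ∃ (q : Poly) (ν : E3), q.totalDegree + 3 ≤ p ∧ t.IsUnitNormal v ν ∧
      f = fun x => (ev q x * ∏ a ∈ Finset.univ.erase v, t.bary a x) • ν}

/-- Lebesgue measure on (the part in `Ω` of) the cell `t`; the part of `t` outside `Ω` lies in the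
boundary of `t` and is a null set. -/
abbrev Cell.vol (t : M.Cell) : Measure E3 := (volume.restrict M.domain).restrict t.body

/-- The space `L²(t; ℝ³)`. -/
abbrev Cell.L2 (t : M.Cell) := Lp E3 2 t.vol

/-- The restriction `w ↦ w|_t` from `L²(Ω; ℝ³)` to `L²(t; ℝ³)`. -/
def Cell.restr (t : M.Cell) : L2v M.domain →ₗ[ℝ] t.L2 :=
  (LpToLpRestrictCLM E3 E3 ℝ (volume.restrict M.domain) 2 t.body).toLinearMap

/-- The local bubble space `Σ_{t,p}` as a subspace of `L²(t; ℝ³)`. -/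
def Cell.bubbleL2 (t : M.Cell) (p : ℕ) : Submodule ℝ t.L2 where
  carrier := {g | ∃ f ∈ t.bubble p, g =ᵐ[t.vol] f}
  zero_mem' := ⟨0, zero_mem _, Lp.coeFn_zero _ _ _⟩
  add_mem' := by
    rintro g k ⟨f, hf, hg⟩ ⟨f', hf', hk⟩
    exact ⟨f + f', add_mem hf hf', (Lp.coeFn_add g k).trans (hg.add hk)⟩
  smul_mem' := by
    rintro c g ⟨f, hf, hg⟩
    exact ⟨c • f, Submodule.smul_mem _ c hf, (Lp.coeFn_smul c g).trans (hg.const_smul c)⟩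

variable (M)

/-- The `r = 2` space `P_{2,p} Λ¹(T_h)`: the fields `w ∈ H(curl; Ω)` whose restriction to each cell
is a polynomial field of degree at most `p`, which are `C¹` at the vertices (at a common vertex of
two cells the two pieces have the same value and the same first order derivatives) and `C⁰` on the
edges (on a common edge of two cells the two pieces coincide). -/
def P2Λ1 (p : ℕ) : Submodule ℝ (L2v M.domain) where
  carrier := {w | w ∈ Hcurl M.domain ∧ ∃ P : M.Cell → Fin 3 → Poly,
    (∀ t i, P t i ∈ MvPolynomial.restrictTotalDegree (Fin 3) ℝ p) ∧
    (∀ t : M.Cell, w =ᵐ[t.vol] evv (P t)) ∧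
    (∀ t t' : M.Cell, ∀ x ∈ t.1, x ∈ t'.1 → ∀ i, AgreeC1 (P t i) (P t' i) x) ∧
    (∀ t t' : M.Cell, ∀ e ⊆ t.1, e ⊆ t'.1 → e.card = 2 →
      ∀ x ∈ convexHull ℝ (e : Set E3), evv (P t) x = evv (P t') x)}
  zero_mem' := ⟨zero_mem _, 0, fun _ _ => zero_mem _,
    fun _ => (ae_restrict_of_ae (Lp.coeFn_zero _ _ _)).mono fun x hx => hx.trans (evv_zero x).symm,
    fun _ _ _ _ _ _ => ⟨rfl, fun _ => rfl⟩, fun _ _ _ _ _ _ _ _ => rfl⟩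
  add_mem' := by
    rintro w v ⟨hw, P, h1, h2, h3, h4⟩ ⟨hv, Q, k1, k2, k3, k4⟩
    refine ⟨add_mem hw hv, P + Q, fun t i => add_mem (h1 t i) (k1 t i), fun t => ?_,
      fun t t' x hx hx' i => (h3 t t' x hx hx' i).add (k3 t t' x hx hx' i),
      fun t t' e he he' hc x hx => ?_⟩
    · filter_upwards [ae_restrict_of_ae (Lp.coeFn_add w v), h2 t, k2 t] with x h a b
      rw [h, Pi.add_apply, a, b, Pi.add_apply, evv_add]
    · rw [Pi.add_apply, Pi.add_apply, evv_add, evv_add, h4 t t' e he he' hc x hx,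
        k4 t t' e he he' hc x hx]
  smul_mem' := by
    rintro c w ⟨hw, P, h1, h2, h3, h4⟩
    refine ⟨Submodule.smul_mem _ c hw, c • P, fun t i => Submodule.smul_mem _ c (h1 t i),
      fun t => ?_, fun t t' x hx hx' i => (h3 t t' x hx hx' i).smul c,
      fun t t' e he he' hc x hx => ?_⟩
    · filter_upwards [ae_restrict_of_ae (Lp.coeFn_smul c w), h2 t] with x h a
      rw [h, Pi.smul_apply, a, Pi.smul_apply, evv_smul]
    · rw [Pi.smul_apply, Pi.smul_apply, evv_smul, evv_smul, h4 t t' e he he' hc x hx]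

/-- The scalar Hermite space of degree `p`: the functions `s ∈ H¹(Ω)` that are continuous on the
closed domain, whose restriction to each cell is a polynomial of degree at most `p`, and which are
`C¹` at the vertices. -/
def hermite (p : ℕ) : Submodule ℝ (L2s M.domain) where
  carrier := {s | s ∈ H1 M.domain ∧
    (∃ f : E3 → ℝ, ContinuousOn f M.closedDomain ∧ s =ᵐ[volume.restrict M.domain] f) ∧
    ∃ P : M.Cell → Poly,
      (∀ t, P t ∈ MvPolynomial.restrictTotalDegree (Fin 3) ℝ p) ∧
      (∀ t : M.Cell, s =ᵐ[t.vol] ev (P t)) ∧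
      (∀ t t' : M.Cell, ∀ x ∈ t.1, x ∈ t'.1 → AgreeC1 (P t) (P t') x)}
  zero_mem' := ⟨zero_mem _, ⟨0, continuousOn_const, Lp.coeFn_zero _ _ _⟩, 0, fun _ => zero_mem _,
    fun _ => (ae_restrict_of_ae (Lp.coeFn_zero _ _ _)).mono fun x hx => hx.trans (ev_zero x).symm,
    fun _ _ _ _ _ => ⟨rfl, fun _ => rfl⟩⟩
  add_mem' := by
    rintro s r ⟨hs, ⟨f, hf, hsf⟩, P, h1, h2, h3⟩ ⟨hr, ⟨g, hg, hrg⟩, Q, k1, k2, k3⟩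
    refine ⟨add_mem hs hr, ⟨f + g, hf.add hg, (Lp.coeFn_add s r).trans (hsf.add hrg)⟩,
      P + Q, fun t => add_mem (h1 t) (k1 t), fun t => ?_,
      fun t t' x hx hx' => (h3 t t' x hx hx').add (k3 t t' x hx hx')⟩
    filter_upwards [ae_restrict_of_ae (Lp.coeFn_add s r), h2 t, k2 t] with x h a b
    rw [h, Pi.add_apply, a, b, Pi.add_apply, ev_add]
  smul_mem' := by
    rintro c s ⟨hs, ⟨f, hf, hsf⟩, P, h1, h2, h3⟩
    refine ⟨Submodule.smul_mem _ c hs,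
      ⟨c • f, hf.const_smul c, (Lp.coeFn_smul c s).trans (hsf.const_smul c)⟩,
      c • P, fun t => Submodule.smul_mem _ c (h1 t), fun t => ?_,
      fun t t' x hx hx' => (h3 t t' x hx hx').smul c⟩
    filter_upwards [ae_restrict_of_ae (Lp.coeFn_smul c s), h2 t] with x h a
    rw [h, Pi.smul_apply, a, Pi.smul_apply, ev_smul, smul_eq_mul]

/-- The vector Hermite space: every Cartesian component lies in the scalar Hermite space. -/
def vectorHermite (p : ℕ) : Submodule ℝ (L2v M.domain) :=
  ⨅ i : Fin 3, (M.hermite p).comap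
    ((EuclideanSpace.proj i : E3 →L[ℝ] ℝ).compLpL 2 (volume.restrict M.domain)).toLinearMap

/-- The global bubble space: the fields whose restriction to each cell `t` lies in the local bubble
space of `t`. No continuity between different cells is imposed. -/
def globalBubble (p : ℕ) : Submodule ℝ (L2v M.domain) :=
  ⨅ t : M.Cell, (t.bubbleL2 p).comap t.restr

end TetMesh

end

noncomputable section

open HCurlFE

namespace TetMesh

variable {M : TetMesh}

/-! ### Geometry of the cells: barycentric coordinates, intersections, null boundaries -/

namespace Cell

/-! The Hermite fields are the continuous ones among the fields in question, and a field in `P2Λ1`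
can fail to be continuous only through its normal component in the interior of faces. The face
bubbles supply exactly these jumps.

Let `w` be given by polynomials `P t` on the cells. Testing the weak curl near an interior point of
a shared face shows that the jump `P t - P t'` is parallel to the face normal `ν`
(`Cell.grad_cr_jump_eq_zero`, `Cell.jump_eq_smul_normal`). No trace theory is used: the test
functions are cut off at distance of order `1/n` from the face, and the derivative of the cutoff
isolates the jump as `n → ∞`. By continuity on edges, the scalar polynomial `ν · (P t - P t')`
vanishes on the three edges of the face. Restricted to the face plane it is therefore divisible by
the product of the three barycentric coordinates, with a quotient of degree at most `p - 3`
(`Cell.exists_face_bubble`). So the jump is the trace of a face bubble, which vanishes on the other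
three faces of its cell.

To remove all jumps at once, each face gets a reference cell depending on its vertex set alone. In
every cell, and for each of its faces, the bubble that carries `P t` to the reference polynomial on
that face is subtracted (`exists_decomposition`). Traces then agree across faces. Bubbles vanish on
edges and to first order at vertices, so the conditions there survive. The remainder is continuous
and piecewise polynomial, hence in `H¹`, and so it is a Hermite field.

Conversely, a field with `H¹` components has a weak curl, and continuity yields agreement on edges.
A bubble has zero tangential trace on the boundary of its cell, so integrating by parts cell by cell
leaves no boundary term, and the piecewise curl is the weak curl (`Cell.integral_face_bubble`,
`Cell.integral_bubble_curl`). Nothing couples bubbles of different cells, so a local bubble extends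
by zero, which gives the statement on restrictions. -/

instance instFinite : Finite M.Cell :=
  (M.finite.subset (t := {t : Finset E3 | t ∈ M.faces ∧ t.card = 4}) fun _ h => h.1).to_subtype

instance instFintype : Fintype M.Cell := Fintype.ofFinite _

theorem range_basis (t : M.Cell) : Set.range t.basis = (t.1 : Set E3) := by
  ext x
  constructor
  · rintro ⟨v, rfl⟩; exact v.2
  · intro h; exact ⟨⟨x, h⟩, rfl⟩

theorem mem_body (t : M.Cell) {x : E3} : x ∈ t.body ↔ ∀ v, 0 ≤ t.bary v x := by
  rw [body, ← range_basis, AffineBasis.convexHull_eq_nonneg_coord]; rfl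

theorem interior_body (t : M.Cell) : interior t.body = {x | ∀ v, 0 < t.bary v x} := by
  rw [body, ← range_basis, AffineBasis.interior_convexHull]; rfl

theorem mem_interior_body (t : M.Cell) {x : E3} : x ∈ interior t.body ↔ ∀ v, 0 < t.bary v x := by
  rw [interior_body]; rfl

theorem bary_self (t : M.Cell) (v : t.1) : t.bary v (v : E3) = 1 := t.basis.coord_apply_eq v

theorem bary_ne (t : M.Cell) {v w : t.1} (h : v ≠ w) : t.bary v (w : E3) = 0 :=
  t.basis.coord_apply_ne h

theorem sum_bary (t : M.Cell) (x : E3) : ∑ v, t.bary v x = 1 := t.basis.sum_coord_apply_eq_one x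

theorem sum_bary_smul (t : M.Cell) (x : E3) : ∑ v, t.bary v x • (v : E3) = x :=
  t.basis.linear_combination_coord_eq_self x

/-- The gradient of a barycentric coordinate, as a linear functional. -/
def grad (t : M.Cell) (v : t.1) : E3 →L[ℝ] ℝ := LinearMap.toContinuousLinearMap (t.basis.coord v).linear

theorem bary_eq (t : M.Cell) (v : t.1) (x y : E3) : t.bary v x = t.grad v (x - y) + t.bary v y := by
  have := (t.basis.coord v).map_vadd y (x - y)
  simpa [bary, grad] using this

theorem bary_add (t : M.Cell) (v : t.1) (x y : E3) : t.bary v (x + y) = t.bary v x + t.grad v y := by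
  rw [t.bary_eq v (x + y) x, add_sub_cancel_left, add_comm]

theorem contDiff_bary (t : M.Cell) (v : t.1) {n : WithTop ℕ∞} : ContDiff ℝ n (t.bary v) := by
  have : t.bary v = fun x => t.grad v x + t.bary v 0 := by
    ext x; simpa using t.bary_eq v x 0
  rw [this]
  exact (t.grad v).contDiff.add contDiff_const

theorem continuous_bary (t : M.Cell) (v : t.1) : Continuous (t.bary v) :=
  (t.contDiff_bary v (n := 0)).continuous

theorem hasFDerivAt_bary (t : M.Cell) (v : t.1) (x : E3) : HasFDerivAt (t.bary v) (t.grad v) x := by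
  have : t.bary v = fun x => t.grad v x + t.bary v 0 := by
    ext x; simpa using t.bary_eq v x 0
  rw [this]
  exact (t.grad v).hasFDerivAt.add_const _

theorem exists_ne (t : M.Cell) (v : t.1) : ∃ a : t.1, a ≠ v := by
  have : 1 < Fintype.card t.1 := by simp [t.2.2]
  exact Fintype.exists_ne_of_one_lt_card this v

theorem grad_ne_zero (t : M.Cell) (v : t.1) : t.grad v ≠ 0 := by
  intro h
  obtain ⟨a, ha⟩ := t.exists_ne v
  have := t.bary_eq v (v : E3) (a : E3)
  rw [bary_self, t.bary_ne ha.symm, h] at this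
  simp at this

theorem convex_body (t : M.Cell) : Convex ℝ t.body := convex_convexHull _ _

theorem isCompact_body (t : M.Cell) : IsCompact t.body :=
  t.1.finite_toSet.isCompact_convexHull ℝ

theorem isClosed_body (t : M.Cell) : IsClosed t.body := t.isCompact_body.isClosed

theorem nonempty_interior (t : M.Cell) : (interior t.body).Nonempty := by
  rw [body, interior_convexHull_nonempty_iff_affineSpan_eq_top, ← range_basis]
  exact t.basis.tot

theorem closure_interior (t : M.Cell) : closure (interior t.body) = t.body := by
  rw [t.convex_body.closure_interior_eq_closure_of_nonempty_interior
    t.nonempty_interior, t.isClosed_body.closure_eq]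

theorem bary_eq_zero_of_mem (t : M.Cell) {s : Set E3} (hs : s ⊆ t.1) {x : E3}
    (hx : x ∈ convexHull ℝ s) (v : t.1) (hv : (v : E3) ∉ s) : t.bary v x = 0 := by
  have : convexHull ℝ s ⊆ {x | t.bary v x = 0} := by
    refine convexHull_min (fun y hy => ?_) ?_
    · have : v ≠ ⟨y, hs hy⟩ := fun h => hv (by rw [h]; exact hy)
      exact t.bary_ne (w := ⟨y, hs hy⟩) this
    · exact Convex.affine_preimage (t.basis.coord v) (convex_singleton (0 : ℝ))
  exact this hx

theorem body_subset (t : M.Cell) : t.body ⊆ M.closedDomain :=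
  Geometry.SimplicialComplex.convexHull_subset_space t.2.1

theorem interior_subset_domain (t : M.Cell) : interior t.body ⊆ M.domain :=
  interior_mono t.body_subset

theorem eq_of_card_inter (t t' : M.Cell) (h : (4 : ℕ) ≤ (t.1 ∩ t'.1 : Finset E3).card) : t = t' := by
  have h1 : t.1 ∩ t'.1 = t.1 := Finset.eq_of_subset_of_card_le Finset.inter_subset_left (by rw [t.2.2]; exact h)
  have h2 : t.1 ∩ t'.1 = t'.1 := Finset.eq_of_subset_of_card_le Finset.inter_subset_right (by rw [t'.2.2]; exact h)
  exact Subtype.ext (h1.symm.trans h2)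

theorem inter_body (t t' : M.Cell) {x : E3} (h : x ∈ t.body) (h' : x ∈ t'.body) :
    x ∈ convexHull ℝ ((t.1 ∩ t'.1 : Finset E3) : Set E3) := by
  rw [Finset.coe_inter]
  exact M.inter_subset_convexHull t.2.1 t'.2.1 ⟨h, h'⟩

/-- Distinct cells meet in the hull of their common vertices, which omit some vertex of `t`. Its
barycentric coordinate vanishes on that hull but is positive in the interior. -/
theorem eq_of_mem_interior (t t' : M.Cell) {x : E3} (h : x ∈ interior t.body) (h' : x ∈ t'.body) :
    t = t' := by
  by_contra hne
  have hc : (t.1 ∩ t'.1 : Finset E3).card < t.1.card := by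
    rw [t.2.2]; by_contra hc; exact hne (eq_of_card_inter t t' (not_lt.1 hc))
  obtain ⟨v, hv, hv'⟩ := Finset.exists_mem_notMem_of_card_lt_card hc
  have := t.bary_eq_zero_of_mem (s := ((t.1 ∩ t'.1 : Finset E3) : Set E3)) (by simp)
    (inter_body t t' (interior_subset h) h') ⟨v, hv⟩ hv'
  exact (t.mem_interior_body.1 h ⟨v, hv⟩).ne' this

/-- The boundary of a convex set is null, so every integral over a cell may be taken over its open
interior, where the cells are disjoint. -/
theorem vol_eq (t : M.Cell) : t.vol = volume.restrict (interior t.body) := by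
  rw [vol, Measure.restrict_restrict t.isClosed_body.measurableSet]
  refine Measure.restrict_congr_set (Filter.EventuallyLE.antisymm ?_ ?_)
  · have h0 : volume (frontier t.body) = 0 := t.convex_body.addHaar_frontier volume
    filter_upwards [compl_mem_ae_iff.2 h0] with x hx h
    by_contra hi
    exact hx ⟨subset_closure h.1, hi⟩
  · exact (show interior t.body ⊆ t.body ∩ M.domain from
      fun x hx => ⟨interior_subset hx, t.interior_subset_domain hx⟩).eventuallyLE

end Cell

theorem closedDomain_eq : M.closedDomain = ⋃ t : M.Cell, t.body := by
  apply Set.Subset.antisymm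
  · intro x hx
    obtain ⟨s, hs, hx⟩ := Geometry.SimplicialComplex.mem_space_iff.1 hx
    obtain ⟨t, ht, hst, hc⟩ := M.pure s hs
    exact Set.mem_iUnion.2 ⟨⟨t, ht, hc⟩, convexHull_mono (by exact_mod_cast hst) hx⟩
  · exact Set.iUnion_subset fun t => t.body_subset

theorem isClosed_closedDomain : IsClosed M.closedDomain := by
  rw [closedDomain_eq]
  exact isClosed_iUnion_of_finite fun t => t.isClosed_body

theorem exists_cell {x : E3} (hx : x ∈ M.closedDomain) : ∃ t : M.Cell, x ∈ t.body := by
  rw [closedDomain_eq] at hx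
  exact Set.mem_iUnion.1 hx

theorem ae_interior : ∀ᵐ x : E3, x ∈ M.closedDomain → ∃ t : M.Cell, x ∈ interior t.body := by
  have : ∀ᵐ x : E3, ∀ t : M.Cell, x ∉ frontier t.body := by
    rw [ae_all_iff]
    intro t
    exact compl_mem_ae_iff.2 (t.convex_body.addHaar_frontier volume)
  filter_upwards [this] with x hx h
  obtain ⟨t, ht⟩ := exists_cell h
  refine ⟨t, ?_⟩
  by_contra hi
  exact hx t ⟨subset_closure ht, hi⟩

theorem ae_domain {q : E3 → Prop} (h : ∀ t : M.Cell, ∀ᵐ x ∂t.vol, q x) :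
    ∀ᵐ x ∂(volume.restrict M.domain), q x := by
  refine (ae_restrict_iff' (show MeasurableSet M.domain from isOpen_interior.measurableSet)).2 ?_
  have h' : ∀ᵐ x : E3, ∀ t : M.Cell, x ∈ interior t.body → q x := by
    rw [ae_all_iff]
    intro t
    have := h t
    rwa [t.vol_eq, ae_restrict_iff' isOpen_interior.measurableSet] at this
  filter_upwards [h', ae_interior (M := M)] with x hx hi hd
  obtain ⟨t, ht⟩ := hi (interior_subset hd)
  exact hx t ht

end TetMesh
-- Polynomials: derivatives, and divisibility from vanishing on the sides of a triangle
namespace HCurlFE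

open MvPolynomial

theorem ev_mul (q r : Poly) (x : E3) : ev (q * r) x = ev q x * ev r x := by simp [ev]

theorem ev_sub (q r : Poly) (x : E3) : ev (q - r) x = ev q x - ev r x := by simp [ev]

theorem ev_C (c : ℝ) (x : E3) : ev (C c) x = c := by simp [ev]

theorem ev_X (i : Fin 3) (x : E3) : ev (X i) x = x i := by simp [ev]

theorem evv_apply (q : Fin 3 → Poly) (x : E3) (i : Fin 3) : evv q x i = ev (q i) x := rfl

theorem evv_sub (q r : Fin 3 → Poly) (x : E3) : evv (q - r) x = evv q x - evv r x := by
  ext i; simp [evv, ev_sub]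

theorem contDiff_ev (q : Poly) {n : WithTop ℕ∞} : ContDiff ℝ n (ev q) := by
  induction q using MvPolynomial.induction_on with
  | C c => simpa [funext (ev_C c)] using contDiff_const
  | add p q hp hq => simpa [funext (ev_add p q)] using hp.add hq
  | mul_X p i hp =>
    have : ev (p * X i) = fun x => ev p x * x i := by ext x; rw [ev_mul, ev_X]
    rw [this]
    exact hp.mul (EuclideanSpace.proj (𝕜 := ℝ) i).contDiff

theorem continuous_ev (q : Poly) : Continuous (ev q) := (contDiff_ev q (n := 0)).continuous

theorem continuous_evv (q : Fin 3 → Poly) : Continuous (evv q) :=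
  (PiLp.continuous_toLp 2 _).comp (continuous_pi fun i => continuous_ev (q i))

/-- The polynomial directional derivative. -/
def dirDeriv (τ : E3) (q : Poly) : Poly := ∑ i, τ i • pderiv i q

theorem fderiv_ev (q : Poly) (x τ : E3) : fderiv ℝ (ev q) x τ = ev (dirDeriv τ q) x := by
  induction q using MvPolynomial.induction_on with
  | C c => simp [funext (ev_C c), dirDeriv, ev_zero]
  | add p q hp hq =>
    have hd := fun p => (contDiff_ev p (n := 1)).differentiable one_ne_zero x
    have : dirDeriv τ (p + q) = dirDeriv τ p + dirDeriv τ q := by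
      simp [dirDeriv, Finset.sum_add_distrib]
    rw [this, ev_add, ← hp, ← hq, show ev (p + q) = ev p + ev q from funext (ev_add p q),
      fderiv_add (hd p) (hd q)]
    rfl
  | mul_X p i hp =>
    have hd := fun p => (contDiff_ev p (n := 1)).differentiable one_ne_zero x
    have h2 : HasFDerivAt (fun x : E3 => x i) (EuclideanSpace.proj (𝕜 := ℝ) i) x :=
      (EuclideanSpace.proj (𝕜 := ℝ) i).hasFDerivAt
    have : ev (p * X i) = fun x => ev p x * x i := by ext x; rw [ev_mul, ev_X]
    rw [this, ((hd p).hasFDerivAt.fun_mul h2).fderiv]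
    have h3 : dirDeriv τ (p * X i) = p * C (τ i) + X i * dirDeriv τ p := by
      simp only [dirDeriv, Derivation.leibniz, smul_eq_mul, pderiv_X, Finset.mul_sum, smul_add,
        Finset.sum_add_distrib]
      congr 1
      · rw [Finset.sum_eq_single i]
        · simp [smul_eq_C_mul, mul_comm]
        · intro b _ hb; simp [hb.symm]
        · simp
      · exact Finset.sum_congr rfl fun j _ => by rw [mul_smul_comm]
    rw [h3, ev_add, ev_mul, ev_mul, ev_C, ev_X, ← hp]
    simp

theorem pd_ev (q : Poly) (i : Fin 3) (x : E3) : pd i (ev q) x = ev (pderiv i q) x := by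
  rw [pd, fderiv_ev, dirDeriv, Finset.sum_eq_single i]
  · simp
  · intro b _ hb; simp [hb]
  · simp

theorem totalDegree_aeval_le {σ τ : Type*} (g : σ → MvPolynomial τ ℝ)
    (hg : ∀ i, (g i).totalDegree ≤ 1) (R : MvPolynomial σ ℝ) :
    (aeval g R).totalDegree ≤ R.totalDegree := by
  rw [aeval_def, eval₂_eq]
  refine totalDegree_finsetSum_le fun d hd => ?_
  refine (totalDegree_mul _ _).trans ?_
  have h1 : (algebraMap ℝ (MvPolynomial τ ℝ) (coeff d R)).totalDegree = 0 := totalDegree_C _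
  rw [h1, zero_add]
  refine (totalDegree_finsetProd _ _).trans ?_
  refine le_trans (Finset.sum_le_sum fun i _ => ?_) (le_totalDegree hd)
  refine (totalDegree_pow _ _).trans ?_
  simpa using Nat.mul_le_mul_left (d i) (hg i)

/-- The substitution `X i ↦ 0` does not change `R` modulo `X i`, and its result vanishes on a
product of infinite sets, so it is the zero polynomial. -/
theorem X_dvd_of_eval_eq_zero {σ : Type*} [Finite σ] [DecidableEq σ] (i : σ) (R : MvPolynomial σ ℝ)
    (s : σ → Set ℝ) (hs : ∀ j, (s j).Infinite)
    (h : ∀ x ∈ Set.pi .univ s, eval (Function.update x i 0) R = 0) : X i ∣ R := by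
  set S : MvPolynomial σ ℝ →ₐ[ℝ] MvPolynomial σ ℝ := aeval (Function.update X i 0)
  have h0 : S R = 0 := by
    have := fun j => (hs j).to_subtype
    refine funext_set s hs fun x hx => ?_
    rw [map_zero, ← h x hx]
    have : (aeval x).comp S = aeval (Function.update x i 0) := by
      ext j
      by_cases hj : j = i
      · subst hj; simp [S]
      · simp [S, hj]
    have := DFunLike.congr_fun this R
    simpa [aeval_eq_eval] using this
  let m := Ideal.Quotient.mkₐ ℝ (Ideal.span {(X i : MvPolynomial σ ℝ)})
  have hm : m.comp S = m := by
    ext j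
    by_cases hj : j = i
    · subst hj
      simp only [AlgHom.comp_apply, S, aeval_X, Function.update_self, map_zero]
      exact (Ideal.Quotient.eq_zero_iff_mem.2 (Ideal.mem_span_singleton_self _)).symm
    · simp [S, hj]
  have : m R = 0 := by rw [← hm, AlgHom.comp_apply, h0, map_zero]
  exact Ideal.mem_span_singleton.1 (Ideal.Quotient.eq_zero_iff_mem.1 this)

/-- The three linear factors are split off one by one. On an open side the factors already removed
are nonzero, so the quotient inherits the vanishing there. -/
theorem exists_triangle_bubble (R : MvPolynomial (Fin 2) ℝ)
    (h0 : ∀ s ∈ Set.Ioo (0 : ℝ) 1, eval ![0, s] R = 0)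
    (h1 : ∀ s ∈ Set.Ioo (0 : ℝ) 1, eval ![s, 0] R = 0)
    (h2 : ∀ s ∈ Set.Ioo (0 : ℝ) 1, eval ![1 - s, s] R = 0) :
    ∃ S, R = X 0 * X 1 * (1 - X 0 - X 1) * S := by
  have hI : ∀ j : Fin 2, ((fun _ => Set.Ioo (0 : ℝ) 1) j).Infinite := fun _ =>
    Set.Ioo_infinite one_pos
  have u0 : ∀ x : Fin 2 → ℝ, Function.update x 0 0 = ![0, x 1] := fun x => by
    ext j; fin_cases j <;> simp
  have u1 : ∀ x : Fin 2 → ℝ, Function.update x 1 0 = ![x 0, 0] := fun x => by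
    ext j; fin_cases j <;> simp
  obtain ⟨R1, rfl⟩ := X_dvd_of_eval_eq_zero 0 R _ hI fun x hx => by
    rw [u0]; exact h0 _ (hx 1 trivial)
  obtain ⟨R2, rfl⟩ := X_dvd_of_eval_eq_zero 1 R1 _ hI fun x hx => by
    have hx0 := hx 0 trivial
    have := h1 _ hx0
    rw [u1]
    simpa [hx0.1.ne'] using this
  -- An affine involution exchanging `X 0` with `1 - X 0 - X 1`; it turns the third side into the
  -- case already settled.
  let θ : MvPolynomial (Fin 2) ℝ →ₐ[ℝ] MvPolynomial (Fin 2) ℝ := aeval ![1 - X 0 - X 1, X 1]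
  have hθ : ∀ Q, θ (θ Q) = Q := by
    intro Q
    have : θ.comp θ = AlgHom.id ℝ _ := by
      ext j : 1
      fin_cases j
      · simp [θ]
        ring
      · simp [θ]
    exact DFunLike.congr_fun this Q
  have hev : ∀ (x : Fin 2 → ℝ) Q, eval x (θ Q) = eval ![1 - x 0 - x 1, x 1] Q := by
    intro x Q
    have : (aeval x).comp θ = aeval ![1 - x 0 - x 1, x 1] := by
      ext j
      fin_cases j
      · simp [θ]
      · simp [θ]
    have := DFunLike.congr_fun this Q
    simpa [aeval_eq_eval] using this
  obtain ⟨R3, hR3⟩ := X_dvd_of_eval_eq_zero 0 (θ R2) _ hI fun x hx => by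
    have hx1 := hx 1 trivial
    have := h2 _ hx1
    have hne : 1 - x 1 ≠ 0 := (sub_pos.2 hx1.2).ne'
    rw [u0, hev]
    simpa [hx1.1.ne', hne] using this
  refine ⟨θ R3, ?_⟩
  have : R2 = (1 - X 0 - X 1) * θ R3 := by
    rw [← hθ R2, hR3, map_mul]
    simp [θ]
  rw [this]
  ring

/-- Degrees add over a domain. This is the source of the bound `p - 3` for the bubble coefficients.
-/
theorem totalDegree_triangle_bubble {S : MvPolynomial (Fin 2) ℝ} (hS : S ≠ 0) :
    S.totalDegree + 3 ≤ (X 0 * X 1 * (1 - X 0 - X 1) * S).totalDegree := by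
  have hl : (1 - X 0 - X 1 : MvPolynomial (Fin 2) ℝ) ≠ 0 := by
    intro h
    have := congrArg (eval ![0, 0]) h
    simp at this
  have hd : 1 ≤ (1 - X 0 - X 1 : MvPolynomial (Fin 2) ℝ).totalDegree := by
    by_contra hc
    have h0 : (1 - X 0 - X 1 : MvPolynomial (Fin 2) ℝ).totalDegree = 0 := by omega
    rw [totalDegree_eq_zero_iff_eq_C] at h0
    have e1 := congrArg (eval ![0, 0]) h0
    have e2 := congrArg (eval ![1, 0]) h0
    simp only [map_sub, map_one, eval_X, eval_C] at e1 e2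
    rw [← e1] at e2
    simp at e2
  have hX : ∀ i : Fin 2, (X i : MvPolynomial (Fin 2) ℝ) ≠ 0 := fun i => X_ne_zero i
  rw [totalDegree_mul_of_isDomain (mul_ne_zero (mul_ne_zero (hX 0) (hX 1)) hl) hS,
    totalDegree_mul_of_isDomain (mul_ne_zero (hX 0) (hX 1)) hl,
    totalDegree_mul_of_isDomain (hX 0) (hX 1), totalDegree_X, totalDegree_X]
  omega

end HCurlFE

namespace TetMesh.Cell

open MvPolynomial

variable {M : TetMesh}

/-- The barycentric coordinate as a polynomial. -/
def baryPoly (t : M.Cell) (v : t.1) : Poly :=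
  C (t.bary v 0) + ∑ i, C (t.grad v (EuclideanSpace.single i 1)) * X i

theorem ev_baryPoly (t : M.Cell) (v : t.1) (x : E3) : ev (t.baryPoly v) x = t.bary v x := by
  have hx : x = ∑ i, x i • EuclideanSpace.single i (1 : ℝ) := by
    ext j; simp [Finset.sum_apply, Pi.single_apply]
  rw [t.bary_eq v x 0, sub_zero]
  conv_rhs => rw [hx]
  rw [map_sum, add_comm, baryPoly, ev_add, ev_C, ev, map_sum]
  congr 1
  refine Finset.sum_congr rfl fun i _ => ?_
  simp [mul_comm]

theorem totalDegree_baryPoly (t : M.Cell) (v : t.1) : (t.baryPoly v).totalDegree ≤ 1 := by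
  refine (totalDegree_add _ _).trans (max_le (by simp) ?_)
  refine totalDegree_finsetSum_le fun i _ => ?_
  refine (totalDegree_mul _ _).trans ?_
  simp

open Classical in
-- The face plane is parametrised by the reference triangle, where the pulled-back polynomial has
-- the triangle bubble as a factor. The quotient returns to space by substituting two barycentric
-- coordinates, which restrict to the plane parameters. The first alternative cannot be absorbed
-- into the second: for `p < 3` even `q = 0` violates the degree condition.
theorem exists_face_bubble (t : M.Cell) (v : t.1) (Q : Poly) {p : ℕ} (hp : Q.totalDegree ≤ p)
    (hQ : ∀ a b : t.1, a ≠ v → b ≠ v → a ≠ b → ∀ x ∈ convexHull ℝ {(a : E3), (b : E3)},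
      ev Q x = 0) :
    (∀ x, t.bary v x = 0 → ev Q x = 0) ∨ ∃ q : Poly, q.totalDegree + 3 ≤ p ∧
      ∀ x, t.bary v x = 0 → ev Q x = ev q x * ∏ a ∈ Finset.univ.erase v, t.bary a x := by
  have hc : (Finset.univ.erase v).card = 3 := by
    rw [Finset.card_erase_of_mem (Finset.mem_univ _)]
    simp [t.2.2]
  obtain ⟨a, b, c, hab, hac, hbc, hs⟩ := Finset.card_eq_three.1 hc
  have hne : ∀ w ∈ ({a, b, c} : Finset t.1), w ≠ v := fun w hw => by
    rw [← hs] at hw; exact Finset.ne_of_mem_erase hw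
  have ha := hne a (by simp)
  have hb := hne b (by simp)
  have hcv := hne c (by simp)
  let g : Fin 3 → MvPolynomial (Fin 2) ℝ := fun i =>
    C ((a : E3) i) + X 0 * C ((b : E3) i - (a : E3) i) + X 1 * C ((c : E3) i - (a : E3) i)
  have hg : ∀ i, (g i).totalDegree ≤ 1 := by
    intro i
    refine (totalDegree_add _ _).trans (max_le ((totalDegree_add _ _).trans (max_le ?_ ?_)) ?_)
    · simp
    · exact (totalDegree_mul _ _).trans (by rw [totalDegree_C, totalDegree_X])
    · exact (totalDegree_mul _ _).trans (by rw [totalDegree_C, totalDegree_X])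
  have hev : ∀ y : Fin 2 → ℝ, eval y (aeval g Q) =
      ev Q ((a : E3) + y 0 • ((b : E3) - a) + y 1 • ((c : E3) - a)) := by
    intro y
    have : ((aeval y).comp (aeval g) : Poly →ₐ[ℝ] ℝ) =
        aeval (fun i => ((a : E3) + y 0 • ((b : E3) - a) + y 1 • ((c : E3) - a)) i) := by
      ext i
      simp [g]
    have := DFunLike.congr_fun this Q
    simpa [aeval_eq_eval, ev] using this
  have seg : ∀ (u w : E3) (s : ℝ), s ∈ Set.Ioo (0 : ℝ) 1 → (1 - s) • u + s • w ∈ convexHull ℝ {u, w} := by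
    intro u w s hs
    rw [convexHull_pair]
    exact ⟨1 - s, s, by linarith [hs.2], hs.1.le, by ring, rfl⟩
  obtain ⟨S, hS⟩ := exists_triangle_bubble (aeval g Q)
    (fun s hs => by
      refine (hev _).trans ((congrArg (ev Q) ?_).trans (hQ a c ha hcv hac _ (seg a c s hs)))
      simp only [Matrix.cons_val_zero, Matrix.cons_val_one]
      module)
    (fun s hs => by
      refine (hev _).trans ((congrArg (ev Q) ?_).trans (hQ a b ha hb hab _ (seg a b s hs)))
      simp only [Matrix.cons_val_zero, Matrix.cons_val_one]
      module)
    (fun s hs => by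
      refine (hev _).trans ((congrArg (ev Q) ?_).trans (hQ b c hb hcv hbc _ (seg b c s hs)))
      simp only [Matrix.cons_val_zero, Matrix.cons_val_one]
      module)
  -- On the plane `λ_v = 0` the parameters of `x` are `λ_b` and `λ_c`, and `λ_a = 1 - λ_b - λ_c`.
  have key : ∀ x, t.bary v x = 0 →
      ev Q x = eval ![t.bary b x, t.bary c x] S * ∏ a ∈ Finset.univ.erase v, t.bary a x := by
    intro x hx
    have h1 := t.sum_bary x
    have h2 := t.sum_bary_smul x
    rw [← Finset.add_sum_erase _ _ (Finset.mem_univ v), hs, hx, Finset.sum_insert (by simp [hab, hac]),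
      Finset.sum_pair hbc] at h1 h2
    have h3 : t.bary a x = 1 - t.bary b x - t.bary c x := by linarith
    have h4 : x = (a : E3) + t.bary b x • ((b : E3) - a) + t.bary c x • ((c : E3) - a) := by
      conv_lhs => rw [← h2, h3]
      module
    have h5 := hev ![t.bary b x, t.bary c x]
    simp only [Matrix.cons_val_zero, Matrix.cons_val_one] at h5
    rw [← h4, hS] at h5
    rw [← h5, hs, Finset.prod_insert (by simp [hab, hac]), Finset.prod_pair hbc, h3]
    simp
    ring
  by_cases h0 : S = 0
  · left
    intro x hx
    rw [key x hx, h0]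
    simp
  · right
    have hSd := totalDegree_triangle_bubble h0
    rw [← hS] at hSd
    have hd : ∀ i : Fin 2, ((![t.baryPoly b, t.baryPoly c] : Fin 2 → Poly) i).totalDegree ≤ 1 := by
      intro i
      fin_cases i
      · exact t.totalDegree_baryPoly b
      · exact t.totalDegree_baryPoly c
    refine ⟨aeval ![t.baryPoly b, t.baryPoly c] S, ?_, fun x hx => ?_⟩
    · have h1 := totalDegree_aeval_le _ hd S
      have h2 := totalDegree_aeval_le g hg Q
      omega
    · rw [key x hx]
      congr 1
      have : ((aeval fun i => x i).comp (aeval ![t.baryPoly b, t.baryPoly c]) :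
          MvPolynomial (Fin 2) ℝ →ₐ[ℝ] ℝ) = aeval ![t.bary b x, t.bary c x] := by
        ext i
        fin_cases i
        · simpa [aeval_eq_eval, ev] using t.ev_baryPoly b x
        · simpa [aeval_eq_eval, ev] using t.ev_baryPoly c x
      have := DFunLike.congr_fun this S
      simpa [aeval_eq_eval, ev] using this.symm

end TetMesh.Cell
-- Integrals of derivatives of continuous, piecewise smooth functions
namespace HCurlFE

open Filter Topology

/-- A function on an interval which is Lipschitz on each member of a finite closed cover is
Lipschitz (between the endpoints). -/
theorem dist_le_of_finite_closed_cover {ι : Type*} (K : ℝ) (f : ℝ → ℝ) (A : ι → Set ℝ)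
    (hA : ∀ i, IsClosed (A i)) (hf : ∀ i, ∀ x ∈ A i, ∀ y ∈ A i, |f x - f y| ≤ K * |x - y|)
    (s : Finset ι) : ∀ a b : ℝ, a ≤ b → Set.Icc a b ⊆ ⋃ i ∈ s, A i → |f a - f b| ≤ K * (b - a) := by
  classical
  induction s using Finset.strongInduction with
  | H s ih =>
    intro a b hab hcov
    obtain ⟨i, hi, hai⟩ := Set.mem_iUnion₂.1 (hcov (Set.left_mem_Icc.2 hab))
    have hc : IsCompact (A i ∩ Set.Icc a b) := isCompact_Icc.inter_left (hA i)
    -- `c` is the last point of `[a, b]` in the piece containing `a`. Beyond it this piece is no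
    -- longer needed, and the induction runs on the remaining ones.
    obtain ⟨c, ⟨hcA, hcI⟩, hmax⟩ := hc.exists_isGreatest ⟨a, hai, Set.left_mem_Icc.2 hab⟩
    have h1 : |f a - f c| ≤ K * (c - a) := by
      have := hf i a hai c hcA
      rwa [abs_sub_comm a c, abs_of_nonneg (sub_nonneg.2 hcI.1)] at this
    rcases hcI.2.eq_or_lt with rfl | hlt
    · exact h1
    have hsub : Set.Ioo c b ⊆ ⋃ j ∈ s.erase i, A j := by
      intro x hx
      obtain ⟨j, hj, hxj⟩ := Set.mem_iUnion₂.1 (hcov ⟨hcI.1.trans hx.1.le, hx.2.le⟩)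
      refine Set.mem_iUnion₂.2 ⟨j, Finset.mem_erase.2 ⟨?_, hj⟩, hxj⟩
      rintro rfl
      exact absurd (hmax ⟨hxj, hcI.1.trans hx.1.le, hx.2.le⟩) (not_le.2 hx.1)
    -- The remaining pieces cover `(c, b)`; being closed and finite in number, they also cover its
    -- closure.
    have hcl : IsClosed (⋃ j ∈ s.erase i, A j) :=
      (s.erase i).finite_toSet.isClosed_biUnion fun j _ => hA j
    have hsub' : Set.Icc c b ⊆ ⋃ j ∈ s.erase i, A j := by
      rw [← closure_Ioo hlt.ne]
      exact hcl.closure_subset_iff.2 hsub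
    have h2 := ih (s.erase i) (Finset.erase_ssubset hi) c b hlt.le hsub'
    calc |f a - f b| ≤ |f a - f c| + |f c - f b| := abs_sub_le _ _ _
      _ ≤ K * (b - a) := by linarith

/-- Restriction to the segment from `x` to `y` reduces this to one dimension, where no convexity of
the pieces is needed. -/
theorem lipschitzWith_of_finite_closed_cover {ι E : Type*} [Finite ι] [NormedAddCommGroup E]
    [NormedSpace ℝ E] {K : NNReal} {f : E → ℝ} {A : ι → Set E} (hA : ∀ i, IsClosed (A i))
    (hcov : ⋃ i, A i = Set.univ) (hf : ∀ i, LipschitzOnWith K f (A i)) : LipschitzWith K f := by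
  have := Fintype.ofFinite ι
  refine LipschitzWith.of_dist_le_mul fun x y => ?_
  let γ : ℝ → E := fun s => x + s • (y - x)
  have hγ : Continuous γ := by fun_prop
  have h := dist_le_of_finite_closed_cover (K * ‖y - x‖) (f ∘ γ) (fun i => γ ⁻¹' A i)
    (fun i => (hA i).preimage hγ) (fun i s hs r hr => by
      have := (hf i).dist_le_mul _ hs _ hr
      rw [Real.dist_eq, dist_eq_norm] at this
      have e : γ s - γ r = (s - r) • (y - x) := by simp only [γ]; module
      rw [e, norm_smul, Real.norm_eq_abs] at this
      simpa [mul_assoc, mul_comm, mul_left_comm] using this) Finset.univ 0 1 zero_le_one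
    (fun s _ => by
      have : γ s ∈ ⋃ i, A i := hcov ▸ Set.mem_univ _
      simpa using this)
  simpa [γ, Real.dist_eq, dist_eq_norm, norm_sub_rev] using h

theorem integral_lineDeriv_eq_zero {F : E3 → ℝ} {K : NNReal} (hF : LipschitzWith K F)
    (hc : HasCompactSupport F) (v : E3) : ∫ x, lineDeriv ℝ F x v = 0 := by
  -- Integration by parts against the constant `1`. The formula reverses the direction, hence `-v`.
  have := LipschitzWith.integral_lineDeriv_mul_eq (μ := (volume : Measure E3))
    (LipschitzWith.const (1 : ℝ) : LipschitzWith 0 fun _ : E3 => (1 : ℝ)) hF hc (-v)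
  simpa [lineDeriv] using this.symm

/-- Integration of the derivative of a continuous, compactly supported, piecewise smooth function. -/
theorem integral_piecewise_deriv_eq_zero {ι : Type*} [Finite ι] {F H : E3 → ℝ} (v : E3)
    {A U : ι → Set E3} {G : ι → E3 → ℝ} (hA : ∀ i, IsClosed (A i)) (hU : ∀ i, IsOpen (U i))
    (hUA : ∀ i, U i ⊆ A i) (hcov : ⋃ i, A i = Set.univ) (hnull : ∀ᵐ x : E3, x ∈ ⋃ i, U i)
    (hG : ∀ i, ContDiff ℝ 1 (G i)) (hGc : ∀ i, HasCompactSupport (G i))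
    (hF : ∀ i, Set.EqOn F (G i) (A i)) (hH : ∀ i, ∀ x ∈ U i, H x = fderiv ℝ (G i) x v) :
    ∫ x, H x = 0 := by
  have := Fintype.ofFinite ι
  choose K hK using fun i => (hG i).lipschitzWith_of_hasCompactSupport (hGc i) one_ne_zero
  have hLip : LipschitzWith (∑ i, K i) F := by
    refine lipschitzWith_of_finite_closed_cover hA hcov fun i x hx y hy => ?_
    rw [hF i hx, hF i hy]
    exact ((hK i).weaken (Finset.single_le_sum (fun _ _ => zero_le) (Finset.mem_univ i))) x y
  have hc : HasCompactSupport F := by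
    refine HasCompactSupport.intro (isCompact_iUnion fun i => (hGc i)) fun x hx => ?_
    have hx' : x ∈ ⋃ i, A i := hcov ▸ Set.mem_univ _
    obtain ⟨i, hi⟩ := Set.mem_iUnion.1 hx'
    rw [hF i hi]
    exact image_eq_zero_of_notMem_tsupport fun h => hx (Set.mem_iUnion.2 ⟨i, h⟩)
  -- `F` is Lipschitz with compact support, and almost every point has a neighbourhood on which `F`
  -- coincides with a smooth piece, so `H` is its line derivative almost everywhere.
  rw [← integral_lineDeriv_eq_zero hLip hc v]
  refine integral_congr_ae ?_
  filter_upwards [hnull] with x hx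
  obtain ⟨i, hi⟩ := Set.mem_iUnion.1 hx
  rw [hH i x hi]
  have he : F =ᶠ[𝓝 x] G i := by
    filter_upwards [(hU i).mem_nhds hi] with y hy using hF i (hUA i hy)
  rw [he.lineDeriv_eq]
  exact (((hG i).differentiable one_ne_zero x).lineDeriv_eq_fderiv).symm

end HCurlFE
-- Gluing cellwise data, and weak derivatives of continuous piecewise polynomials
namespace TetMesh

open Filter Topology MvPolynomial

variable {M : TetMesh}

section Glue

variable {F : Type*} [NormedAddCommGroup F]

/-- The function which is given by `P t` in the interior of each cell `t`, and zero elsewhere. -/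
def glue (P : M.Cell → E3 → F) (x : E3) : F := ∑ t, (interior t.body).indicator (P t) x

theorem glue_eq (P : M.Cell → E3 → F) (t : M.Cell) {x : E3} (hx : x ∈ interior t.body) :
    glue P x = P t x := by
  rw [glue, Finset.sum_eq_single t, Set.indicator_of_mem hx]
  · intro t' _ hne
    refine Set.indicator_of_notMem (fun h => hne ?_) _
    exact Cell.eq_of_mem_interior t' t h (interior_subset hx)
  · simp

theorem glue_eq_zero (P : M.Cell → E3 → F) {x : E3} (hx : x ∉ M.domain) : glue P x = 0 :=
  Finset.sum_eq_zero fun t _ => Set.indicator_of_notMem (fun h => hx (t.interior_subset_domain h)) _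

theorem glue_ae (P : M.Cell → E3 → F) (t : M.Cell) : glue P =ᵐ[t.vol] P t := by
  rw [t.vol_eq]
  filter_upwards [ae_restrict_mem isOpen_interior.measurableSet] with x hx using glue_eq P t hx

theorem memLp_glue {P : M.Cell → E3 → F} (hP : ∀ t, Continuous (P t)) :
    MemLp (glue P) 2 (volume.restrict M.domain) := by
  refine MemLp.restrict _ ?_
  have : glue P = ∑ t, (interior t.body).indicator (P t) := by ext x; simp [glue]
  rw [this]
  refine memLp_finsetSum' _ fun t _ => ?_
  rw [memLp_indicator_iff_restrict isOpen_interior.measurableSet]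
  have hfin : IsFiniteMeasure (volume.restrict (interior t.body)) :=
    ⟨by rw [Measure.restrict_apply_univ]
        exact (measure_mono interior_subset).trans_lt t.isCompact_body.measure_lt_top⟩
  obtain ⟨C, hC⟩ := t.isCompact_body.exists_bound_of_continuousOn (hP t).continuousOn
  refine MemLp.of_bound ?_ C ?_
  · exact ((hP t).continuousOn).aestronglyMeasurable_of_isCompact t.isCompact_body
      t.isCompact_body.measurableSet |>.mono_measure (Measure.restrict_mono interior_subset le_rfl)
  · filter_upwards [ae_restrict_mem isOpen_interior.measurableSet] with x hx
    exact hC x (interior_subset hx)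

/-- The element of `L²` which is given by `P t` on each cell `t`. -/
def glueL2 (P : M.Cell → E3 → F) (hP : ∀ t, Continuous (P t)) :
    Lp F 2 (volume.restrict M.domain) := (memLp_glue hP).toLp

theorem glueL2_ae (P : M.Cell → E3 → F) (hP : ∀ t, Continuous (P t)) (t : M.Cell) :
    glueL2 P hP =ᵐ[t.vol] P t :=
  EventuallyEq.trans (g := glue P) (ae_restrict_of_ae (MemLp.coeFn_toLp (memLp_glue hP)))
    (glue_ae P t)

theorem setIntegral_glue [NormedSpace ℝ F] (P : M.Cell → E3 → F) :
    ∫ x in M.domain, glue P x = ∫ x, glue P x :=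
  setIntegral_eq_integral_of_forall_compl_eq_zero fun _ hx => glue_eq_zero P hx

end Glue

/-- The product `f φ` is continuous, compactly supported and smooth on each piece. By the product
rule the claim says that its derivative integrates to zero. -/
theorem hasWeakPartial_of_piecewise (P : M.Cell → Poly) (f : E3 → ℝ)
    (hf : ∀ t, Set.EqOn f (ev (P t)) t.body) (s : L2s M.domain)
    (hs : ∀ t : M.Cell, s =ᵐ[t.vol] ev (P t)) (i : Fin 3) :
    HasWeakPartial M.domain i s
      (glueL2 (fun t => ev (pderiv i (P t))) fun _ => continuous_ev _) := by
  intro φ hφ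
  set g := glueL2 (fun t : M.Cell => ev (pderiv i (P t))) fun t => continuous_ev _
  have i1 := integrable_mul_test s (continuous_pd hφ.1 i) (compactSupport_pd hφ.2.1 i)
  have i2 := integrable_mul_test g hφ.1.continuous hφ.2.1
  rw [eq_neg_iff_add_eq_zero, ← integral_add i1 i2]
  have hφ0 : ∀ x ∉ M.domain, φ x = 0 := fun x hx =>
    image_eq_zero_of_notMem_tsupport fun h => hx (hφ.2.2 h)
  have hdφ := hφ.1.differentiable (by simp)
  have h1 : ∫ x in M.domain, (s x * pd i φ x + g x * φ x) = ∫ x in M.domain,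
      glue (fun t : M.Cell => fun x => ev (P t) x * pd i φ x + ev (pderiv i (P t)) x * φ x) x := by
    refine integral_congr_ae (ae_domain fun t => ?_)
    filter_upwards [hs t, glueL2_ae (fun t : M.Cell => ev (pderiv i (P t)))
      (fun t => continuous_ev _) t, glue_ae (fun t : M.Cell => fun x =>
        ev (P t) x * pd i φ x + ev (pderiv i (P t)) x * φ x) t] with x a b c
    rw [c, a, b]
  rw [h1, setIntegral_glue]
  -- The index `none` stands for the exterior: `φ` vanishes off `Ω`, so zero is a smooth piece on
  -- the closed set `Ωᶜ`.
  refine integral_piecewise_deriv_eq_zero (ι := Option M.Cell) (F := fun x => f x * φ x)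
    (EuclideanSpace.single i 1)
    (A := fun o => o.elim M.domainᶜ fun t => t.body)
    (U := fun o => o.elim M.closedDomainᶜ fun t => interior t.body)
    (G := fun o => o.elim 0 fun t => fun x => ev (P t) x * φ x) ?_ ?_ ?_ ?_ ?_ ?_ ?_ ?_ ?_
  · rintro (_ | t)
    · exact (show IsOpen M.domain from isOpen_interior).isClosed_compl
    · exact t.isClosed_body
  · rintro (_ | t)
    · exact isClosed_closedDomain.isOpen_compl
    · exact isOpen_interior
  · rintro (_ | t)
    · exact Set.compl_subset_compl.2 interior_subset
    · exact interior_subset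
  · refine Set.eq_univ_of_forall fun x => ?_
    by_cases hx : x ∈ M.domain
    · obtain ⟨t, ht⟩ := exists_cell (interior_subset hx)
      exact Set.mem_iUnion.2 ⟨some t, ht⟩
    · exact Set.mem_iUnion.2 ⟨none, hx⟩
  · filter_upwards [ae_interior (M := M)] with x hx
    by_cases hc : x ∈ M.closedDomain
    · obtain ⟨t, ht⟩ := hx hc
      exact Set.mem_iUnion.2 ⟨some t, ht⟩
    · exact Set.mem_iUnion.2 ⟨none, hc⟩
  · rintro (_ | t)
    · exact contDiff_const
    · exact (contDiff_ev _).mul (hφ.1.of_le (by simp))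
  · rintro (_ | t)
    · exact HasCompactSupport.zero
    · exact hφ.2.1.mul_left
  · rintro (_ | t) x hx
    · simp [hφ0 x hx]
    · simp [hf t hx]
  · rintro (_ | t) x hx
    · have : x ∉ M.domain := fun h => hx (interior_subset h)
      rw [glue_eq_zero _ this]
      simp
    · rw [glue_eq _ t hx]
      have := ((contDiff_ev (P t) (n := 1)).differentiable one_ne_zero x).hasFDerivAt.fun_mul
        (hdφ x).hasFDerivAt
      simp only [Option.elim]
      rw [this.fderiv, ← pd_ev]
      simp [pd, mul_comm]

theorem mem_H1_of_piecewise (P : M.Cell → Poly) (f : E3 → ℝ)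
    (hf : ∀ t, Set.EqOn f (ev (P t)) t.body) (s : L2s M.domain)
    (hs : ∀ t : M.Cell, s =ᵐ[t.vol] ev (P t)) : s ∈ H1 M.domain :=
  fun i => ⟨_, hasWeakPartial_of_piecewise P f hf s hs i⟩

/-! ### Tangential derivatives of face bubbles integrate to zero over a cell -/

namespace Cell

theorem ae_bary_ne_zero (t : M.Cell) (v : t.1) : ∀ᵐ x : E3, t.bary v x ≠ 0 := by
  let S : AffineSubspace ℝ E3 := (AffineSubspace.mk' (0 : ℝ) ⊥).comap (t.basis.coord v)
  have hS : ∀ x, x ∈ S ↔ t.bary v x = 0 := fun x => by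
    simp [S, bary, AffineSubspace.mem_comap, AffineSubspace.mem_mk']
  have hne : S ≠ ⊤ := by
    intro h
    have : (v : E3) ∈ S := h ▸ AffineSubspace.mem_top _ _ _
    rw [hS, bary_self] at this
    exact one_ne_zero this
  filter_upwards [compl_mem_ae_iff.2 (Measure.addHaar_affineSubspace volume S hne)] with x hx h
  exact hx ((hS x).2 h)

open Classical in
-- A divergence theorem without boundary terms: the integrand is the derivative of a function
-- vanishing on three faces, and `τ` is tangent to the fourth. The fourth face is treated by a
-- smooth factor `h n` in `λ_v` alone. It is constant along `τ`, vanishes for `λ_v ≤ 0`, and tends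
-- to the indicator of `λ_v > 0`.
theorem integral_face_bubble (t : M.Cell) (v : t.1) {τ : E3} (hτ : t.grad v τ = 0) (q : Poly)
    {ψ : E3 → ℝ} (hψ : ContDiff ℝ ∞ ψ) (hc : HasCompactSupport ψ) :
    ∫ x, fderiv ℝ (fun x => (ev q x * ∏ a ∈ Finset.univ.erase v, t.bary a x) * ψ x) x τ ∂t.vol = 0 := by
  set g : E3 → ℝ := fun x => (ev q x * ∏ a ∈ Finset.univ.erase v, t.bary a x) * ψ x with hg
  have hgs : ContDiff ℝ 1 g :=
    ((contDiff_ev q).mul (contDiff_prod fun a _ => t.contDiff_bary a)).mul (hψ.of_le (by simp))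
  have hgc : HasCompactSupport g := hc.mul_left
  have hd : Continuous fun x => fderiv ℝ g x τ :=
    (hgs.continuous_fderiv one_ne_zero).clm_apply continuous_const
  have hdc : HasCompactSupport fun x => fderiv ℝ g x τ := hgc.fderiv_apply ℝ τ
  let h : ℕ → E3 → ℝ := fun n x => Real.smoothTransition (n * t.bary v x)
  let Up : Set E3 := {x | ∀ a, a ≠ v → 0 < t.bary a x}
  have hUp : IsOpen Up := by
    have : Up = ⋂ a, ⋂ (_ : a ≠ v), {x | 0 < t.bary a x} := by ext; simp [Up]
    rw [this]
    exact isOpen_iInter_of_finite fun a => isOpen_iInter_of_finite fun _ =>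
      isOpen_lt continuous_const (t.continuous_bary a)
  let Um : Set E3 := ⋃ a, ⋃ (_ : a ≠ v), {x | t.bary a x < 0}
  let Ap : Set E3 := ⋂ a, ⋂ (_ : a ≠ v), {x | 0 ≤ t.bary a x}
  let Am : Set E3 := ⋃ a, ⋃ (_ : a ≠ v), {x | t.bary a x ≤ 0}
  have hzero : ∀ n, ∫ x, Up.indicator (fun x => h n x * fderiv ℝ g x τ) x = 0 := by
    intro n
    have hh : ContDiff ℝ 1 (h n) :=
      Real.smoothTransition.contDiff.comp (contDiff_const.mul (t.contDiff_bary v))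
    have hhd : ∀ x, fderiv ℝ (h n) x τ = 0 := by
      intro x
      have h1 : HasFDerivAt (fun x => (n : ℝ) * t.bary v x) ((n : ℝ) • t.grad v) x :=
        (t.hasFDerivAt_bary v x).const_mul _
      have h2 : HasDerivAt Real.smoothTransition (deriv Real.smoothTransition (n * t.bary v x))
        (n * t.bary v x) := ((Real.smoothTransition.contDiff (n := 1)).differentiable (by simp) _).hasDerivAt
      have := h2.comp_hasFDerivAt x h1
      rw [show h n = Real.smoothTransition ∘ fun x => (n : ℝ) * t.bary v x from rfl, this.fderiv]
      simp [hτ]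
    -- The function is cut off outside the cone where all `λ_a`, `a ≠ v`, are nonnegative. It stays
    -- continuous because `g` has each of these `λ_a` as a factor.
    refine integral_piecewise_deriv_eq_zero (ι := Bool) (F := Ap.indicator fun x => h n x * g x) τ
      (A := fun b => cond b Ap Am) (U := fun b => cond b Up Um)
      (G := fun b => cond b (fun x => h n x * g x) 0) ?_ ?_ ?_ ?_ ?_ ?_ ?_ ?_ ?_
    · rintro (_ | _)
      · exact isClosed_iUnion_of_finite fun a => isClosed_iUnion_of_finite fun _ =>
          isClosed_le (t.continuous_bary a) continuous_const
      · exact isClosed_iInter fun a => isClosed_iInter fun _ =>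
          isClosed_le continuous_const (t.continuous_bary a)
    · rintro (_ | _)
      · exact isOpen_iUnion fun a => isOpen_iUnion fun _ =>
          isOpen_lt (t.continuous_bary a) continuous_const
      · exact hUp
    · rintro (_ | _)
      · exact Set.iUnion₂_mono fun a _ x (hx : t.bary a x < 0) => show t.bary a x ≤ 0 from hx.le
      · exact fun x hx => Set.mem_iInter₂.2 fun a ha => (hx a ha).le
    · refine Set.eq_univ_of_forall fun x => ?_
      by_cases hx : x ∈ Ap
      · exact Set.mem_iUnion.2 ⟨true, hx⟩
      · simp only [Ap, Set.mem_iInter, not_forall] at hx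
        obtain ⟨a, ha, hx⟩ := hx
        exact Set.mem_iUnion.2 ⟨false, Set.mem_iUnion₂.2 ⟨a, ha, show t.bary a x ≤ 0 from (not_le.1 hx).le⟩⟩
    · filter_upwards [ae_all_iff.2 t.ae_bary_ne_zero] with x hx
      by_cases hxp : x ∈ Up
      · exact Set.mem_iUnion.2 ⟨true, hxp⟩
      · simp only [Up, Set.mem_ofPred_eq, not_forall] at hxp
        obtain ⟨a, ha, hxp⟩ := hxp
        exact Set.mem_iUnion.2 ⟨false, Set.mem_iUnion₂.2 ⟨a, ha, lt_of_le_of_ne (not_lt.1 hxp) (hx a)⟩⟩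
    · rintro (_ | _)
      · exact contDiff_const
      · exact hh.mul hgs
    · rintro (_ | _)
      · exact HasCompactSupport.zero
      · exact hgc.mul_left
    · rintro (_ | _) x hx
      · obtain ⟨a, ha, hxa⟩ := Set.mem_iUnion₂.1 hx
        by_cases hxp : x ∈ Ap
        · have h0 : t.bary a x = 0 := le_antisymm hxa (Set.mem_iInter₂.1 hxp a ha)
          have hp : ∏ a ∈ Finset.univ.erase v, t.bary a x = 0 :=
            Finset.prod_eq_zero (Finset.mem_erase.2 ⟨ha, Finset.mem_univ a⟩) h0
          rw [Set.indicator_of_mem hxp]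
          simp only [hg, hp, mul_zero, zero_mul]
          rfl
        · rw [Set.indicator_of_notMem hxp]; rfl
      · exact Set.indicator_of_mem hx _
    · rintro (_ | _) x hx
      · obtain ⟨a, ha, hxa⟩ := Set.mem_iUnion₂.1 hx
        rw [Set.indicator_of_notMem fun hxp => (hxp a ha).not_gt hxa]
        simp
      · rw [Set.indicator_of_mem (show x ∈ Up from hx)]
        have := (hh.differentiable one_ne_zero x).hasFDerivAt.fun_mul
          (hgs.differentiable one_ne_zero x).hasFDerivAt
        simp only [cond_true]
        rw [this.fderiv]
        simp [hhd x]
  -- Inside the cone, `h n` equals one as soon as `n λ_v ≥ 1`, so the pointwise limit is supported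
  -- in the open cell.
  have hlim : Tendsto (fun n => ∫ x, Up.indicator (fun x => h n x * fderiv ℝ g x τ) x) atTop
      (𝓝 (∫ x, (interior t.body).indicator (fun x => fderiv ℝ g x τ) x)) := by
    refine tendsto_integral_of_dominated_convergence (fun x => ‖fderiv ℝ g x τ‖) ?_ ?_ ?_ ?_
    · intro n
      refine AEStronglyMeasurable.indicator ?_ hUp.measurableSet
      refine Continuous.aestronglyMeasurable (Continuous.mul ?_ hd)
      exact Real.smoothTransition.continuous.comp (continuous_const.mul (t.continuous_bary v))
    · exact (hd.integrable_of_hasCompactSupport hdc).norm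
    · intro n
      refine Eventually.of_forall fun x => ?_
      refine (norm_indicator_le_norm_self _ _).trans ?_
      rw [norm_mul]
      refine mul_le_of_le_one_left (norm_nonneg _) ?_
      rw [Real.norm_eq_abs, abs_of_nonneg (Real.smoothTransition.nonneg _)]
      exact Real.smoothTransition.le_one _
    · refine Eventually.of_forall fun x => ?_
      by_cases hxp : x ∈ Up
      · simp only [Set.indicator_of_mem hxp]
        rcases lt_or_ge 0 (t.bary v x) with hv | hv
        · have hx : x ∈ interior t.body := t.mem_interior_body.2 fun a => by
            by_cases ha : a = v
            · exact ha ▸ hv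
            · exact hxp a ha
          rw [Set.indicator_of_mem hx]
          refine tendsto_const_nhds.congr' ?_
          obtain ⟨N, hN⟩ := exists_nat_ge (1 / t.bary v x)
          filter_upwards [eventually_ge_atTop N] with n hn
          have : 1 ≤ n * t.bary v x := by
            rw [← div_le_iff₀ hv]
            exact hN.trans (by exact_mod_cast hn)
          simp only [h]
          rw [Real.smoothTransition.one_of_one_le this, one_mul]
        · have hx : x ∉ interior t.body := fun hx => (t.mem_interior_body.1 hx v).not_ge hv
          rw [Set.indicator_of_notMem hx]
          refine tendsto_const_nhds.congr fun n => ?_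
          simp only [h]
          rw [Real.smoothTransition.zero_of_nonpos (mul_nonpos_of_nonneg_of_nonpos (by positivity) hv),
            zero_mul]
      · have hx : x ∉ interior t.body := fun hx => hxp fun a _ => t.mem_interior_body.1 hx a
        simp only [Set.indicator_of_notMem hxp, Set.indicator_of_notMem hx]
        exact tendsto_const_nhds
  simp only [hzero] at hlim
  rw [t.vol_eq, ← integral_indicator isOpen_interior.measurableSet]
  exact tendsto_nhds_unique hlim tendsto_const_nhds

end Cell

end TetMesh
-- The local bubble space: vanishing on edges and at vertices, and the curl
namespace HCurlFE

open MvPolynomial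

theorem fderiv_eq_sum_pd (ψ : E3 → ℝ) (x τ : E3) : fderiv ℝ ψ x τ = ∑ j, τ j * pd j ψ x := by
  have hx : τ = ∑ i, τ i • EuclideanSpace.single i (1 : ℝ) := by
    ext j; simp [Finset.sum_apply, Pi.single_apply]
  conv_lhs => rw [hx]
  simp [pd]

/-- The cross product on Euclidean three-space. -/
def cr (a b : E3) : E3 :=
  !₂[a 1 * b 2 - a 2 * b 1, a 2 * b 0 - a 0 * b 2, a 0 * b 1 - a 1 * b 0]

theorem inner_cr_right (a b : E3) : inner ℝ b (cr a b) = 0 := by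
  simp [cr, PiLp.inner_apply, Fin.sum_univ_three]
  ring

/-- Only derivatives along `e_k × ν` occur. These directions are orthogonal to `ν`, so for a face
normal they are tangent to the face. -/
theorem inner_curl (ν : E3) (φ : E3 → E3) (x : E3) :
    inner ℝ ν (curl φ x) =
      ∑ k, fderiv ℝ (fun y => φ y k) x (cr (EuclideanSpace.single k 1) ν) := by
  simp only [fderiv_eq_sum_pd, Fin.sum_univ_three]
  simp [cr, curl, PiLp.inner_apply, Fin.sum_univ_three]
  ring

theorem ev_pderiv_mul_mul_eq_zero {X Y Z : Poly} {x : E3} (hX : ev X x = 0) (hY : ev Y x = 0)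
    (j : Fin 3) : ev (pderiv j (X * (Y * Z))) x = 0 := by
  simp [Derivation.leibniz, ev_add, ev_mul, hX, hY]

end HCurlFE

namespace TetMesh.Cell

open MvPolynomial

variable {M : TetMesh}

/-- Writing `x - a` as the barycentric combination of the edge vectors `w - a`, all terms but that
of `v` are orthogonal to `ν`. -/
theorem inner_normal (t : M.Cell) {v a : t.1} (ha : a ≠ v) {ν : E3} (hν : t.IsUnitNormal v ν)
    (x : E3) : inner ℝ ν (x - (a : E3)) = t.bary v x * inner ℝ ν ((v : E3) - (a : E3)) := by
  have h : x - (a : E3) = ∑ w, t.bary w x • ((w : E3) - (a : E3)) := by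
    simp only [smul_sub, Finset.sum_sub_distrib, ← Finset.sum_smul, sum_bary, sum_bary_smul, one_smul]
  rw [h, inner_sum, Finset.sum_eq_single v]
  · rw [inner_smul_right]
  · intro w _ hw
    rw [inner_smul_right, hν.2 w a hw ha, mul_zero]
  · simp

theorem inner_normal_ne_zero (t : M.Cell) {v a : t.1} (ha : a ≠ v) {ν : E3}
    (hν : t.IsUnitNormal v ν) : inner ℝ ν ((v : E3) - (a : E3)) ≠ 0 := by
  intro h
  have := t.inner_normal ha hν (ν + (a : E3))
  rw [h, mul_zero, add_sub_cancel_right, real_inner_self_eq_norm_sq, hν.1] at this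
  norm_num at this

/-- The normal and the gradient of `λ_v` are nonzero multiples of each other, so both describe the
directions tangent to the face. -/
theorem grad_eq_zero_iff (t : M.Cell) {v : t.1} {ν : E3} (hν : t.IsUnitNormal v ν) (τ : E3) :
    t.grad v τ = 0 ↔ inner ℝ ν τ = 0 := by
  obtain ⟨a, ha⟩ := t.exists_ne v
  have h := t.inner_normal ha hν (a + τ)
  rw [add_sub_cancel_left, t.bary_add, t.bary_ne ha.symm, zero_add] at h
  rw [h]
  simp [t.inner_normal_ne_zero ha hν]

open Classical in
/-- The polynomial representing a generator of the scalar face bubbles. -/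
def bubblePoly (t : M.Cell) (v : t.1) (q : Poly) : Poly :=
  q * ∏ a ∈ Finset.univ.erase v, t.baryPoly a

open Classical in
theorem ev_bubblePoly (t : M.Cell) (v : t.1) (q : Poly) (x : E3) :
    ev (t.bubblePoly v q) x = ev q x * ∏ a ∈ Finset.univ.erase v, t.bary a x := by
  rw [bubblePoly, ev_mul]
  congr 1
  rw [ev, map_prod]
  exact Finset.prod_congr rfl fun a _ => t.ev_baryPoly a x

theorem card_erase (t : M.Cell) (v : t.1) [DecidableEq t.1] : (Finset.univ.erase v).card = 3 := by
  rw [Finset.card_erase_of_mem (Finset.mem_univ _)]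
  simp [t.2.2]

theorem totalDegree_bubblePoly (t : M.Cell) (v : t.1) (q : Poly) :
    (t.bubblePoly v q).totalDegree ≤ q.totalDegree + 3 := by
  classical
  refine (totalDegree_mul _ _).trans (Nat.add_le_add_left ?_ _)
  refine (totalDegree_finsetProd _ _).trans ?_
  refine (Finset.sum_le_card_nsmul _ _ 1 fun a _ => t.totalDegree_baryPoly a).trans ?_
  rw [card_erase]
  rfl

/-- At most one of the three barycentric factors is nonzero at a vertex. The other two vanish there,
and a product with two vanishing factors vanishes to first order. -/
theorem bubblePoly_vertex (t : M.Cell) (v w : t.1) (q : Poly) :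
    ev (t.bubblePoly v q) (w : E3) = 0 ∧ ∀ j, ev (pderiv j (t.bubblePoly v q)) (w : E3) = 0 := by
  classical
  have hc : 1 < ((Finset.univ.erase v).erase w).card := by
    have := Finset.pred_card_le_card_erase (s := Finset.univ.erase v) (a := w)
    rw [card_erase] at this
    omega
  obtain ⟨a, ha, b, hb, hab⟩ := Finset.one_lt_card.1 hc
  have e : t.bubblePoly v q = t.baryPoly a * (t.baryPoly b *
      (q * ∏ c ∈ ((Finset.univ.erase v).erase a).erase b, t.baryPoly c)) := by
    rw [bubblePoly, ← Finset.mul_prod_erase _ _ (Finset.mem_of_mem_erase ha),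
      ← Finset.mul_prod_erase _ _ (Finset.mem_erase.2 ⟨hab.symm, Finset.mem_of_mem_erase hb⟩)]
    ring
  have h0 : ∀ c ∈ (Finset.univ.erase v).erase w, ev (t.baryPoly c) (w : E3) = 0 := fun c hc => by
    rw [ev_baryPoly, t.bary_ne (Finset.ne_of_mem_erase hc)]
  rw [e]
  exact ⟨by rw [ev_mul, h0 a ha, zero_mul],
    ev_pderiv_mul_mul_eq_zero (h0 a ha) (h0 b hb)⟩

theorem integrable_evv_inner (t : M.Cell) (B : Fin 3 → Poly) {ψ : E3 → E3} (h : Continuous ψ)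
    (hc : HasCompactSupport ψ) : Integrable (fun x => inner ℝ (evv B x) (ψ x)) t.vol := by
  refine Integrable.restrict (Integrable.restrict (Continuous.integrable_of_hasCompactSupport
    ((continuous_evv _).inner h) ?_))
  exact HasCompactSupport.intro hc fun x hx => by
    rw [image_eq_zero_of_notMem_tsupport hx, inner_zero_right]

/-- With `τ_k = e_k × ν`, the difference of the integrands is `∑ ∂_{τ_k} (β φ_k)`, a sum of
derivatives tangent to the face opposite `v`, to which `integral_face_bubble` applies. -/
theorem integral_bubble_curl (t : M.Cell) {v : t.1} {ν : E3} (hν : t.IsUnitNormal v ν) (q : Poly)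
    {φ : E3 → E3} (hφ : ContDiff ℝ ∞ φ) (hc : HasCompactSupport φ) :
    ∫ x, inner ℝ (evv (fun i => ν i • t.bubblePoly v q) x) (curl φ x) ∂t.vol =
      ∫ x, inner ℝ (evv (fun k => -dirDeriv (cr (EuclideanSpace.single k 1) ν) (t.bubblePoly v q)) x)
        (φ x) ∂t.vol := by
  classical
  set β := t.bubblePoly v q with hβ
  have hcφ : ∀ k, HasCompactSupport fun y => φ y k := fun k =>
    hc.comp_left (g := fun z : E3 => z k) rfl
  rw [← sub_eq_zero, ← integral_sub
    (t.integrable_evv_inner _ (continuous_curl hφ) (compactSupport_curl hc))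
    (t.integrable_evv_inner _ hφ.continuous hc)]
  have hd := fun p x => ((contDiff_ev p (n := 1)).differentiable one_ne_zero x)
  have hdφ := fun k x => (contDiff_coord hφ k).differentiable (by simp) x
  have e : ∀ x, inner ℝ (evv (fun i => ν i • β) x) (curl φ x) -
      inner ℝ (evv (fun k => -dirDeriv (cr (EuclideanSpace.single k 1) ν) β) x) (φ x) =
      ∑ k, fderiv ℝ (fun y => ev β y * φ y k) x (cr (EuclideanSpace.single k 1) ν) := by
    intro x
    have e1 : evv (fun i => ν i • β) x = ev β x • ν := by
      ext i; simp [evv, ev_smul, mul_comm]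
    have e2 : ∀ k, fderiv ℝ (fun y => ev β y * φ y k) x (cr (EuclideanSpace.single k 1) ν) =
        ev β x * fderiv ℝ (fun y => φ y k) x (cr (EuclideanSpace.single k 1) ν) +
        φ x k * ev (dirDeriv (cr (EuclideanSpace.single k 1) ν) β) x := by
      intro k
      rw [((hd β x).hasFDerivAt.fun_mul (hdφ k x).hasFDerivAt).fderiv, ← fderiv_ev]
      simp
    have e3 : ∀ r x, ev (-r) x = -ev r x := fun r x => by simp [ev]
    rw [e1, inner_smul_left, inner_curl, Finset.mul_sum]
    simp only [e2, Finset.sum_add_distrib]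
    rw [sub_eq_add_neg]
    congr 1
    rw [PiLp.inner_apply, ← Finset.sum_neg_distrib]
    refine Finset.sum_congr rfl fun k _ => ?_
    simp [evv, e3]
  simp only [e]
  have hcd : ∀ k, ContDiff ℝ 1 fun y => ev β y * φ y k := fun k =>
    (contDiff_ev β).mul ((contDiff_coord hφ k).of_le (by simp))
  rw [integral_finsetSum]
  · refine Finset.sum_eq_zero fun k _ => ?_
    have hg : t.grad v (cr (EuclideanSpace.single k 1) ν) = 0 :=
      (t.grad_eq_zero_iff hν _).2 (inner_cr_right _ _)
    have := t.integral_face_bubble v hg q (contDiff_coord hφ k) (hcφ k)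
    simpa only [hβ, ev_bubblePoly] using this
  · intro k _
    refine Integrable.restrict (Integrable.restrict (Continuous.integrable_of_hasCompactSupport
      (((hcd k).continuous_fderiv one_ne_zero).clm_apply continuous_const) ?_))
    exact ((hcφ k).mul_left).fderiv_apply ℝ _

/-- The properties of the elements of the local bubble space that are used below. -/
structure IsBubble (t : M.Cell) (p : ℕ) (B : Fin 3 → Poly) : Prop where
  degree : ∀ i, B i ∈ restrictTotalDegree (Fin 3) ℝ p
  vertex : ∀ i, ∀ x ∈ t.1, AgreeC1 (B i) 0 x
  edge : ∀ x, ∀ a b, a ≠ b → t.bary a x = 0 → t.bary b x = 0 → evv B x = 0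
  curl : ∃ C : Fin 3 → Poly, ∀ φ, ContDiff ℝ ∞ φ → HasCompactSupport φ →
    ∫ x, inner ℝ (evv B x) (curl φ x) ∂t.vol = ∫ x, inner ℝ (evv C x) (φ x) ∂t.vol

theorem IsBubble.zero (t : M.Cell) (p : ℕ) : t.IsBubble p 0 where
  degree _ := zero_mem _
  vertex _ _ _ := ⟨rfl, fun _ => rfl⟩
  edge _ _ _ _ _ _ := evv_zero _
  curl := ⟨0, fun φ _ _ => by simp [evv_zero]⟩

theorem IsBubble.add {t : M.Cell} {p : ℕ} {B B' : Fin 3 → Poly} (h : t.IsBubble p B)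
    (h' : t.IsBubble p B') : t.IsBubble p (B + B') where
  degree i := add_mem (h.degree i) (h'.degree i)
  vertex i x hx := by simpa using (h.vertex i x hx).add (h'.vertex i x hx)
  edge x a b hab ha hb := by rw [evv_add, h.edge x a b hab ha hb, h'.edge x a b hab ha hb, add_zero]
  curl := by
    obtain ⟨C, hC⟩ := h.curl
    obtain ⟨C', hC'⟩ := h'.curl
    refine ⟨C + C', fun φ hφ hc => ?_⟩
    have i1 := fun B => t.integrable_evv_inner B (continuous_curl hφ) (compactSupport_curl hc)
    have i2 := fun B => t.integrable_evv_inner B hφ.continuous hc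
    simp only [evv_add, inner_add_left]
    rw [integral_add (i1 _) (i1 _), integral_add (i2 _) (i2 _), hC φ hφ hc, hC' φ hφ hc]

theorem IsBubble.smul {t : M.Cell} {p : ℕ} {B : Fin 3 → Poly} (c : ℝ) (h : t.IsBubble p B) :
    t.IsBubble p (c • B) where
  degree i := Submodule.smul_mem _ c (h.degree i)
  vertex i x hx := by simpa using (h.vertex i x hx).smul c
  edge x a b hab ha hb := by rw [evv_smul, h.edge x a b hab ha hb, smul_zero]
  curl := by
    obtain ⟨C, hC⟩ := h.curl
    refine ⟨c • C, fun φ hφ hc => ?_⟩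
    simp only [evv_smul, inner_smul_left]
    rw [integral_const_mul, integral_const_mul, hC φ hφ hc]

theorem isBubble_bubblePoly (t : M.Cell) {p : ℕ} {v : t.1} {ν : E3} (hν : t.IsUnitNormal v ν)
    {q : Poly} (hq : q.totalDegree + 3 ≤ p) : t.IsBubble p fun i => ν i • t.bubblePoly v q where
  degree i := Submodule.smul_mem _ _
    ((mem_restrictTotalDegree _ _ _).2 ((t.totalDegree_bubblePoly v q).trans hq))
  vertex i x hx := by
    have := t.bubblePoly_vertex v ⟨x, hx⟩ q
    refine ⟨?_, fun j => ?_⟩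
    · rw [ev_smul, this.1, ev_zero, mul_zero]
    · rw [Derivation.map_smul, ev_smul, this.2 j, map_zero, ev_zero, mul_zero]
  edge x a b hab ha hb := by
    classical
    -- Of two distinct vanishing coordinates at least one is not `λ_v`, and that one is a factor of
    -- the bubble.
    have : ∃ c, c ≠ v ∧ t.bary c x = 0 := by
      by_cases h : a = v
      · exact ⟨b, fun hb => hab (h.trans hb.symm), hb⟩
      · exact ⟨a, h, ha⟩
    obtain ⟨c, hc, hcx⟩ := this
    ext i
    rw [evv_apply, ev_smul, ev_bubblePoly,
      Finset.prod_eq_zero (Finset.mem_erase.2 ⟨hc, Finset.mem_univ c⟩) hcx]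
    simp
  curl := ⟨_, fun _ hφ hc => t.integral_bubble_curl hν q hφ hc⟩

open Classical in
theorem evv_smul_bubblePoly (t : M.Cell) (v : t.1) (ν : E3) (q : Poly) :
    evv (fun i => ν i • t.bubblePoly v q) =
      fun x => (ev q x * ∏ a ∈ Finset.univ.erase v, t.bary a x) • ν := by
  ext x i
  rw [evv_apply, ev_smul, ev_bubblePoly]
  simp [mul_comm]

theorem exists_isBubble (t : M.Cell) {p : ℕ} {f : E3 → E3} (hf : f ∈ t.bubble p) :
    ∃ B, t.IsBubble p B ∧ f = evv B := by
  rw [bubble] at hf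
  have hadd : ∀ f g : E3 → E3, (∃ B, t.IsBubble p B ∧ f = evv B) →
      (∃ B, t.IsBubble p B ∧ g = evv B) → ∃ B, t.IsBubble p B ∧ f + g = evv B := by
    rintro _ _ ⟨B, hB, rfl⟩ ⟨B', hB', rfl⟩
    exact ⟨B + B', hB.add hB', by ext1 x; rw [evv_add]; rfl⟩
  have hzero : ∃ B, t.IsBubble p B ∧ (0 : E3 → E3) = evv B :=
    ⟨0, .zero t p, by ext1 x; rw [evv_zero]; rfl⟩
  refine Submodule.iSup_induction _ (motive := fun f => ∃ B, t.IsBubble p B ∧ f = evv B) hf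
    (fun v g hg => ?_) hzero hadd
  refine Submodule.span_induction ?_ hzero (fun f g _ _ => hadd f g) ?_ hg
  · rintro _ ⟨q, ν, hq, hν, rfl⟩
    exact ⟨_, t.isBubble_bubblePoly hν hq, (t.evv_smul_bubblePoly v ν q).symm⟩
  · rintro c _ _ ⟨B, hB, rfl⟩
    exact ⟨c • B, hB.smul c, by ext1 x; rw [evv_smul]; rfl⟩

end TetMesh.Cell

/-! ### A concentration argument near a plane -/

namespace HCurlFE

open Filter Topology MvPolynomial

/-- A fixed open set of thickness `η` is covered by about `η / δ` translates of the slab, whose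
thickness `δ` is proportional to `ε`. Translation invariance then bounds the volume of the slab
below by a multiple of `ε`. -/
theorem exists_slab_volume {ℓ : E3 →L[ℝ] ℝ} (hℓ : ℓ ≠ 0) (x₀ : E3) {r : ℝ} (hr : 0 < r)
    {s₁ s₂ : ℝ} (h₁ : 0 ≤ s₁) (h₂ : s₁ < s₂) : ∃ c > 0, ∃ ε₀ > 0, ∀ ε, 0 < ε → ε ≤ ε₀ →
      c * ε ≤ volume.real (Metric.ball x₀ r ∩ {x | s₁ * ε ≤ ℓ (x - x₀) ∧ ℓ (x - x₀) ≤ s₂ * ε}) := by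
  obtain ⟨m, hm⟩ : ∃ m, ℓ m = 1 := by
    obtain ⟨y, hy⟩ := DFunLike.ne_iff.1 hℓ
    exact ⟨(ℓ y)⁻¹ • y, by rw [map_smul, smul_eq_mul, inv_mul_cancel₀ hy]⟩
  have hm0 : 0 < ‖m‖ := norm_pos_iff.2 fun h => by simp [h] at hm
  -- A translation along `m` by at most `η` moves points by at most `r / 8`, so the ball of radius
  -- `r / 2` stays inside the ball of radius `r`.
  set η := r / (8 * ‖m‖) with hη
  have hη0 : 0 < η := by positivity
  set B : Set E3 := Metric.ball x₀ (r / 2) ∩ {x | 0 < ℓ (x - x₀) ∧ ℓ (x - x₀) < η} with hB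
  have hcont : Continuous fun x => ℓ (x - x₀) := by fun_prop
  have hBo : IsOpen B := Metric.isOpen_ball.inter
    ((isOpen_lt continuous_const hcont).inter (isOpen_lt hcont continuous_const))
  have hBne : B.Nonempty := by
    refine ⟨x₀ + (η / 2) • m, ?_, ?_⟩
    · rw [mem_ball_iff_norm, add_sub_cancel_left, norm_smul, Real.norm_eq_abs, abs_of_pos (by positivity),
        hη]
      have : r / (8 * ‖m‖) / 2 * ‖m‖ = r / 16 := by field_simp; ring
      rw [this]
      linarith
    · show 0 < ℓ (x₀ + (η / 2) • m - x₀) ∧ ℓ (x₀ + (η / 2) • m - x₀) < η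
      rw [add_sub_cancel_left, map_smul, hm]
      simp only [smul_eq_mul, mul_one]
      constructor <;> linarith
  have hfin : ∀ A : Set E3, ∀ R, A ⊆ Metric.ball x₀ R → volume A ≠ ⊤ := fun A R h =>
    ((measure_mono h).trans_lt measure_ball_lt_top).ne
  have hV : 0 < volume.real B :=
    ENNReal.toReal_pos (hBo.measure_pos volume hBne).ne' (hfin B _ Set.inter_subset_left)
  -- The two bounds in `ε₀` ensure `δ ≤ η`, which gives `⌈η / δ⌉ ≤ 2 η / δ`, and `s₁ ε ≤ η`, which
  -- keeps the shifts short.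
  refine ⟨volume.real B * (s₂ - s₁) / (2 * η), by have := sub_pos.2 h₂; positivity,
    min (η / (s₂ - s₁)) (η / (s₁ + 1)), lt_min (div_pos hη0 (sub_pos.2 h₂)) (by positivity),
    fun ε hε hle => ?_⟩
  set S := Metric.ball x₀ r ∩ {x | s₁ * ε ≤ ℓ (x - x₀) ∧ ℓ (x - x₀) ≤ s₂ * ε} with hS
  set δ := (s₂ - s₁) * ε with hδ
  have hδ0 : 0 < δ := mul_pos (sub_pos.2 h₂) hε
  have hδη : δ ≤ η := by
    have := hle.trans (min_le_left _ _)
    rw [le_div_iff₀ (sub_pos.2 h₂)] at this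
    rw [hδ]; linarith
  have hs₁ : s₁ * ε ≤ η := by
    have := hle.trans (min_le_right _ _)
    rw [le_div_iff₀ (by positivity)] at this
    nlinarith
  set N := ⌈η / δ⌉₊ with hN
  -- Since `ℓ m = 1`, this shift carries the layer `kδ ≤ ℓ < (k + 1)δ` into `s₁ ε ≤ ℓ ≤ s₂ ε`.
  let u : ℕ → E3 := fun k => (s₁ * ε - k * δ) • m
  have hcov : B ⊆ ⋃ k ∈ Finset.range N, (fun x => x + u k) ⁻¹' S := by
    intro x hx
    obtain ⟨hxb, hx0, hxη⟩ := hx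
    set k := ⌊ℓ (x - x₀) / δ⌋₊ with hk
    have hk1 : k * δ ≤ ℓ (x - x₀) := by
      rw [← le_div_iff₀ hδ0]; exact Nat.floor_le (by positivity)
    have hk2 : ℓ (x - x₀) < (k + 1) * δ := by
      rw [← div_lt_iff₀ hδ0]; exact Nat.lt_floor_add_one _
    have hkN : k < N := by
      have : (k : ℝ) < N := by
        refine lt_of_lt_of_le ?_ (Nat.le_ceil _)
        rw [lt_div_iff₀ hδ0]
        linarith
      exact_mod_cast this
    refine Set.mem_iUnion₂.2 ⟨k, Finset.mem_range.2 hkN, ?_, ?_⟩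
    · have hu : ‖u k‖ ≤ r / 8 := by
        rw [norm_smul, Real.norm_eq_abs]
        have : |s₁ * ε - k * δ| ≤ η := by
          rw [abs_le]
          have : 0 ≤ s₁ * ε := by positivity
          have : 0 ≤ k * δ := by positivity
          constructor <;> linarith
        calc |s₁ * ε - k * δ| * ‖m‖ ≤ η * ‖m‖ := by gcongr
          _ = r / 8 := by rw [hη]; field_simp
      rw [mem_ball_iff_norm] at hxb ⊢
      calc ‖x + u k - x₀‖ = ‖(x - x₀) + u k‖ := by congr 1; abel
        _ ≤ ‖x - x₀‖ + ‖u k‖ := norm_add_le _ _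
        _ < r := by linarith
    · show s₁ * ε ≤ ℓ (x + u k - x₀) ∧ ℓ (x + u k - x₀) ≤ s₂ * ε
      have : ℓ (x + u k - x₀) = ℓ (x - x₀) + (s₁ * ε - k * δ) := by
        rw [show x + u k - x₀ = (x - x₀) + u k by abel, map_add, map_smul, hm, smul_eq_mul, mul_one]
      rw [this]
      constructor
      · linarith
      · have : s₂ * ε = s₁ * ε + δ := by rw [hδ]; ring
        linarith
  have hle2 : volume B ≤ N * volume S := by
    refine (measure_mono hcov).trans ((measure_biUnion_finset_le _ _).trans ?_)
    simp only [measure_preimage_add_right, Finset.sum_const, Finset.card_range, nsmul_eq_mul]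
    exact le_rfl
  have hle3 : volume.real B ≤ N * volume.real S := by
    have := ENNReal.toReal_mono (ENNReal.mul_ne_top (by simp) (hfin S _ Set.inter_subset_left)) hle2
    simpa [Measure.real, ENNReal.toReal_mul] using this
  have hN2 : (N : ℝ) ≤ 2 * η / δ := by
    have h1 := Nat.ceil_lt_add_one (div_pos hη0 hδ0).le
    have h2 : 1 ≤ η / δ := (one_le_div hδ0).2 hδη
    have : 2 * η / δ = η / δ + η / δ := by ring
    rw [this]
    exact (h1.trans_le (by linarith)).le
  have hfinal : volume.real B ≤ 2 * η / δ * volume.real S :=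
    hle3.trans (mul_le_mul_of_nonneg_right hN2 measureReal_nonneg)
  rw [div_mul_eq_mul_div, le_div_iff₀ hδ0] at hfinal
  rw [div_mul_eq_mul_div, div_le_iff₀ (by positivity), mul_assoc, ← hδ]
  linarith

/-- A smooth cutoff function on the line, which equals one near zero. -/
def cutoff (s : ℝ) : ℝ := Real.smoothTransition (2 - s) * Real.smoothTransition (2 + s)

theorem contDiff_cutoff {n : ℕ∞} : ContDiff ℝ n cutoff :=
  (Real.smoothTransition.contDiff.comp (contDiff_const.sub contDiff_id)).mul
    (Real.smoothTransition.contDiff.comp (contDiff_const.add contDiff_id))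

theorem cutoff_nonneg (s : ℝ) : 0 ≤ cutoff s :=
  mul_nonneg (Real.smoothTransition.nonneg _) (Real.smoothTransition.nonneg _)

theorem cutoff_le_one (s : ℝ) : cutoff s ≤ 1 :=
  mul_le_one₀ (Real.smoothTransition.le_one _) (Real.smoothTransition.nonneg _)
    (Real.smoothTransition.le_one _)

theorem cutoff_eq_zero {s : ℝ} (h : 2 ≤ |s|) : cutoff s = 0 := by
  rcases le_abs.1 h with h | h
  · rw [cutoff, Real.smoothTransition.zero_of_nonpos (by linarith), zero_mul]
  · rw [cutoff, Real.smoothTransition.zero_of_nonpos (x := 2 + s) (by linarith), mul_zero]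

theorem cutoff_of_nonneg {s : ℝ} (h : -1 ≤ s) : cutoff s = Real.smoothTransition (2 - s) := by
  rw [cutoff, Real.smoothTransition.one_of_one_le (x := 2 + s) (by linarith), mul_one]

theorem deriv_cutoff_nonpos {s : ℝ} (h : 0 ≤ s) : deriv cutoff s ≤ 0 := by
  have h1 : cutoff =ᶠ[𝓝 s] fun s => Real.smoothTransition (2 - s) := by
    filter_upwards [Ioi_mem_nhds (show (-1 : ℝ) < s by linarith)] with y hy
      using cutoff_of_nonneg (le_of_lt hy)
  rw [h1.deriv_eq]
  refine Antitone.deriv_nonpos fun a b hab => ?_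
  exact Real.smoothTransition.monotone (by linarith)

theorem continuous_deriv_cutoff : Continuous (deriv cutoff) :=
  (contDiff_cutoff (n := 1)).continuous_deriv (by simp)

/-- The cutoff falls from one to zero between `1` and `2`, so its slope is `-1` somewhere, and
continuity of the derivative gives an interval. -/
theorem exists_deriv_cutoff_le : ∃ s₁ s₂ : ℝ, 0 ≤ s₁ ∧ s₁ < s₂ ∧
    ∀ s, s₁ ≤ s → s ≤ s₂ → deriv cutoff s ≤ -(1 / 2) := by
  obtain ⟨s, hs, hd⟩ := exists_deriv_eq_slope cutoff one_lt_two (contDiff_cutoff (n := 1)).continuous.continuousOn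
    ((contDiff_cutoff (n := 1)).differentiable (by simp)).differentiableOn
  have h1 : cutoff 1 = 1 := by
    rw [cutoff_of_nonneg (by norm_num), Real.smoothTransition.one_of_one_le (by norm_num)]
  have h2 : cutoff 2 = 0 := cutoff_eq_zero (by norm_num)
  have hlt : deriv cutoff s < -(1 / 2) := by rw [hd, h1, h2]; norm_num
  obtain ⟨ε, hε, hb⟩ := Metric.eventually_nhds_iff_ball.1
    (continuous_deriv_cutoff.continuousAt.eventually_lt_const hlt)
  refine ⟨s, s + ε / 2, by linarith [hs.1], by linarith, fun y h1 h2 => (hb y ?_).le⟩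
  rw [Metric.mem_ball, Real.dist_eq, abs_lt]
  constructor <;> linarith

/-- On the half-space the kernel `n · cutoff'(n ℓ)` is nonpositive, and it is at most `-n / 2` on a
slab whose volume is at least a multiple of `1 / n`. If `G x₀ > 0`, a bump supported where `G`
exceeds `G x₀ / 2` keeps the integrals below a negative constant. -/
theorem nonpos_of_concentrated_integral_tendsto {ℓ : E3 →L[ℝ] ℝ} (hℓ : ℓ ≠ 0) {x₀ : E3} {r : ℝ}
    (hr : 0 < r) {G : E3 → ℝ} (hG : Continuous G)
    (h : ∀ ρ : E3 → ℝ, ContDiff ℝ ∞ ρ → HasCompactSupport ρ → tsupport ρ ⊆ Metric.ball x₀ r →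
      Tendsto (fun n : ℕ => ∫ x in {x | 0 ≤ ℓ (x - x₀)},
        (n * deriv cutoff (n * ℓ (x - x₀))) * (ρ x * G x)) atTop (𝓝 0)) : G x₀ ≤ 0 := by
  by_contra hpos
  push Not at hpos
  obtain ⟨r', hr', hb⟩ := Metric.eventually_nhds_iff_ball.1
    (hG.continuousAt.eventually_const_lt (half_lt_self hpos))
  have hmin : 0 < min r r' := lt_min hr hr'
  let b : ContDiffBump x₀ := ⟨min r r' / 3, min r r' / 2, by positivity, by linarith⟩
  have hsupp : tsupport b ⊆ Metric.ball x₀ (min r r') := by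
    rw [b.tsupport_eq]
    exact Metric.closedBall_subset_ball (show min r r' / 2 < min r r' by linarith)
  have hlim := h b b.contDiff b.hasCompactSupport
    (hsupp.trans (Metric.ball_subset_ball (min_le_left _ _)))
  obtain ⟨s₁, s₂, h₁, h₂, hder⟩ := exists_deriv_cutoff_le
  obtain ⟨c, hc, ε₀, hε₀, hslab⟩ := exists_slab_volume hℓ x₀ (show 0 < min r r' / 3 by positivity) h₁ h₂
  have hcont : Continuous fun x => ℓ (x - x₀) := by fun_prop
  have hk : ∀ n : ℕ, Continuous fun x => (n * deriv cutoff (n * ℓ (x - x₀))) * (b x * G x) := fun n =>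
    (continuous_const.mul (continuous_deriv_cutoff.comp (continuous_const.mul hcont))).mul
      (b.continuous.mul hG)
  have hbound : ∀ᶠ n : ℕ in atTop, ∫ x in {x | 0 ≤ ℓ (x - x₀)},
      (n * deriv cutoff (n * ℓ (x - x₀))) * (b x * G x) ≤ -(G x₀ / 4 * c) := by
    obtain ⟨N, hN⟩ := exists_nat_ge (1 / ε₀)
    filter_upwards [eventually_ge_atTop N, eventually_gt_atTop 0] with n hn hn0
    have hn0' : (0 : ℝ) < n := by exact_mod_cast hn0
    have hε : (n : ℝ)⁻¹ ≤ ε₀ := by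
      rw [inv_le_comm₀ hn0' hε₀, ← one_div]
      exact hN.trans (by exact_mod_cast hn)
    have hvol := hslab _ (inv_pos.2 hn0') hε
    set S := Metric.ball x₀ (min r r' / 3) ∩
      {x | s₁ * (n : ℝ)⁻¹ ≤ ℓ (x - x₀) ∧ ℓ (x - x₀) ≤ s₂ * (n : ℝ)⁻¹} with hS
    have hSm : MeasurableSet S := measurableSet_ball.inter
      ((isClosed_le continuous_const hcont).inter (isClosed_le hcont continuous_const)).measurableSet
    have hHm : MeasurableSet {x | 0 ≤ ℓ (x - x₀)} := (isClosed_le continuous_const hcont).measurableSet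
    have hSfin : volume S < ⊤ := (measure_mono Set.inter_subset_left).trans_lt measure_ball_lt_top
    rw [← integral_indicator hHm]
    calc ∫ x, Set.indicator {x | 0 ≤ ℓ (x - x₀)}
          (fun x => (n * deriv cutoff (n * ℓ (x - x₀))) * (b x * G x)) x
        -- On `S` the bump is one, `G > G x₀ / 2` and the slope is at most `-1/2`; elsewhere the
        -- integrand is nonpositive.
        ≤ ∫ x, S.indicator (fun _ => -(n * (G x₀ / 4))) x := by
          refine integral_mono ?_ ?_ fun x => ?_
          · refine Integrable.indicator ((hk n).integrable_of_hasCompactSupport ?_) hHm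
            exact (b.hasCompactSupport.mul_right).mul_left
          · exact (integrable_indicator_iff hSm).2 (integrableOn_const hSfin.ne)
          · by_cases hxS : x ∈ S
            · obtain ⟨hxb, hx1, hx2⟩ := hxS
              have hxH : 0 ≤ ℓ (x - x₀) := le_trans (by positivity) hx1
              rw [Set.indicator_of_mem (show x ∈ S from ⟨hxb, hx1, hx2⟩),
                Set.indicator_of_mem (show x ∈ {x | 0 ≤ ℓ (x - x₀)} from hxH)]
              have e1 : b x = 1 := b.one_of_mem_closedBall (Metric.ball_subset_closedBall hxb)
              have e2 : G x₀ / 2 < G x := hb x (Metric.ball_subset_ball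
                ((div_le_self hmin.le (by norm_num)).trans (min_le_right _ _)) hxb)
              have e3 : deriv cutoff (n * ℓ (x - x₀)) ≤ -(1 / 2) := by
                refine hder _ ?_ ?_
                · rw [← div_eq_mul_inv, div_le_iff₀ hn0'] at hx1; linarith
                · rw [← div_eq_mul_inv, le_div_iff₀ hn0'] at hx2; linarith
              rw [e1, one_mul]
              have e4 : deriv cutoff (n * ℓ (x - x₀)) * G x ≤ -(G x₀ / 4) := by nlinarith
              calc n * deriv cutoff (n * ℓ (x - x₀)) * G x
                  = n * (deriv cutoff (n * ℓ (x - x₀)) * G x) := by ring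
                _ ≤ n * -(G x₀ / 4) := by gcongr
                _ = -(n * (G x₀ / 4)) := by ring
            · rw [Set.indicator_of_notMem hxS]
              by_cases hxH : 0 ≤ ℓ (x - x₀)
              · rw [Set.indicator_of_mem (show x ∈ {x | 0 ≤ ℓ (x - x₀)} from hxH)]
                have e3 : n * deriv cutoff (n * ℓ (x - x₀)) ≤ 0 :=
                  mul_nonpos_of_nonneg_of_nonpos hn0'.le (deriv_cutoff_nonpos (by positivity))
                refine mul_nonpos_of_nonpos_of_nonneg e3 ?_
                by_cases hx : x ∈ tsupport b
                · have := hb x (Metric.ball_subset_ball (min_le_right _ _) (hsupp hx))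
                  exact mul_nonneg b.nonneg (by linarith)
                · rw [image_eq_zero_of_notMem_tsupport hx, zero_mul]
              · rw [Set.indicator_of_notMem (show x ∉ {x | 0 ≤ ℓ (x - x₀)} from hxH)]
      _ = volume.real S * -(n * (G x₀ / 4)) := by
          rw [integral_indicator hSm, setIntegral_const, smul_eq_mul]
      _ ≤ -(G x₀ / 4 * c) := by
          rw [← div_eq_mul_inv, div_le_iff₀ hn0'] at hvol
          nlinarith
  have := ge_of_tendsto (hlim.neg) (hbound.mono fun n hn => neg_le_neg hn)
  have h4 : 0 < G x₀ / 4 * c := by positivity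
  linarith

theorem eq_zero_of_concentrated_integral_tendsto {ℓ : E3 →L[ℝ] ℝ} (hℓ : ℓ ≠ 0) {x₀ : E3} {r : ℝ}
    (hr : 0 < r) {G : E3 → ℝ} (hG : Continuous G)
    (h : ∀ ρ : E3 → ℝ, ContDiff ℝ ∞ ρ → HasCompactSupport ρ → tsupport ρ ⊆ Metric.ball x₀ r →
      Tendsto (fun n : ℕ => ∫ x in {x | 0 ≤ ℓ (x - x₀)},
        (n * deriv cutoff (n * ℓ (x - x₀))) * (ρ x * G x)) atTop (𝓝 0)) : G x₀ = 0 := by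
  refine le_antisymm (nonpos_of_concentrated_integral_tendsto hℓ hr hG h) ?_
  have := nonpos_of_concentrated_integral_tendsto hℓ hr hG.neg fun ρ h1 h2 h3 => by
    have := (h ρ h1 h2 h3).neg
    simpa [← integral_neg] using this
  simpa using this

theorem integral_fderiv_evv (Q : Fin 3 → Poly) {ψ : E3 → ℝ} (hψ : ContDiff ℝ ∞ ψ)
    (hc : HasCompactSupport ψ) :
    ∫ x, fderiv ℝ ψ x (evv Q x) = - ∫ x, ev (∑ j, pderiv j (Q j)) x * ψ x := by
  have hd := hψ.differentiable (by simp)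
  have hde := fun p x => ((contDiff_ev p (n := 1)).differentiable one_ne_zero x)
  have i1 : ∀ j, Integrable fun x => ev (Q j) x * pd j ψ x := fun j =>
    ((continuous_ev _).mul (continuous_pd hψ j)).integrable_of_hasCompactSupport
      (compactSupport_pd hc j).mul_left
  have i2 : ∀ q, Integrable fun x => ev q x * ψ x := fun q =>
    ((continuous_ev _).mul hψ.continuous).integrable_of_hasCompactSupport hc.mul_left
  have hj : ∀ j, ∫ x, ev (Q j) x * pd j ψ x = - ∫ x, ev (pderiv j (Q j)) x * ψ x := by
    intro j
    simp only [← pd_ev]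
    refine integral_mul_fderiv_eq_neg_fderiv_mul_of_integrable ?_ (i1 j) (i2 _)
      (fun x _ => hde _ x) (fun x _ => hd x)
    have := i2 (pderiv j (Q j))
    simp only [← pd_ev] at this
    exact this
  have e : ∀ x, ev (∑ j, pderiv j (Q j)) x * ψ x = ∑ j, ev (pderiv j (Q j)) x * ψ x := fun x => by
    rw [ev, map_sum, Finset.sum_mul]; rfl
  simp only [fderiv_eq_sum_pd, e]
  rw [integral_finsetSum _ fun j _ => i2 _, ← Finset.sum_neg_distrib]
  simp only [← hj]
  exact integral_finsetSum _ fun j _ => i1 j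

/-- The cross product of a constant vector with a polynomial vector field. -/
def crPoly (a : E3) (Q : Fin 3 → Poly) : Fin 3 → Poly :=
  ![a 1 • Q 2 - a 2 • Q 1, a 2 • Q 0 - a 0 • Q 2, a 0 • Q 1 - a 1 • Q 0]

theorem evv_crPoly (a : E3) (Q : Fin 3 → Poly) (x : E3) : evv (crPoly a Q) x = cr a (evv Q x) := by
  ext i
  fin_cases i <;> simp [crPoly, evv, cr, ev_sub, ev_smul]

/-- The curl of `ψ a` is `∇ψ × a`, and the scalar triple product is cyclic. -/
theorem inner_curl_smul_const (D a : E3) {ψ : E3 → ℝ} {x : E3} (hψ : DifferentiableAt ℝ ψ x) :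
    inner ℝ D (curl (fun y => ψ y • a) x) = fderiv ℝ ψ x (cr a D) := by
  have h : ∀ i k, pd i (fun y => (ψ y • a) k) x = pd i ψ x * a k := by
    intro i k
    have : (fun y => (ψ y • a) k) = fun y => ψ y * a k := by ext y; simp
    rw [this, pd, fderiv_mul_const hψ]
    simp [pd, mul_comm]
  rw [fderiv_eq_sum_pd]
  simp only [curl, h]
  simp [cr, PiLp.inner_apply, Fin.sum_univ_three]
  ring

/-- As `ν · (a × D) = a · (D × ν)` for all `a`, the product `D × ν` vanishes. The formula is then `ν
× (D × ν) = D - (ν · D) ν`. -/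
theorem eq_smul_of_inner_cr_eq_zero {ν D : E3} (hν : ‖ν‖ = 1)
    (h : ∀ a, inner ℝ ν (cr a D) = 0) : D = (inner ℝ ν D : ℝ) • ν := by
  have h1 : ν 0 * ν 0 + ν 1 * ν 1 + ν 2 * ν 2 = 1 := by
    have := real_inner_self_eq_norm_sq ν
    rw [hν, PiLp.inner_apply, Fin.sum_univ_three] at this
    simpa only [RCLike.inner_apply, conj_trivial, one_pow] using this
  have e0 := h (EuclideanSpace.single 0 1)
  have e1 := h (EuclideanSpace.single 1 1)
  have e2 := h (EuclideanSpace.single 2 1)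
  simp [cr, PiLp.inner_apply, Fin.sum_univ_three] at e0 e1 e2
  ext i
  fin_cases i <;> simp [PiLp.inner_apply, Fin.sum_univ_three]
  · linear_combination (-D 0) * h1 + ν 1 * e2 - ν 2 * e1
  · linear_combination (-D 1) * h1 - ν 0 * e2 + ν 2 * e0
  · linear_combination (-D 2) * h1 + ν 0 * e1 - ν 1 * e0

end HCurlFE

/-! ### The jump across a shared face is normal to the face -/

namespace TetMesh

open Filter Topology MvPolynomial

variable {M : TetMesh}

namespace Cell

theorem bary_sum (t : M.Cell) (v : t.1) {ι : Type*} (s : Finset ι) (w : ι → ℝ) (z : ι → E3)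
    (hw : ∑ i ∈ s, w i = 1) : t.bary v (∑ i ∈ s, w i • z i) = ∑ i ∈ s, w i * t.bary v (z i) := by
  have h : ∀ x, t.bary v x = t.grad v x + t.bary v 0 := fun x => by simpa using t.bary_eq v x 0
  rw [h, map_sum]
  conv_rhs =>
    enter [2, i]
    rw [h]
  simp only [mul_add, Finset.sum_add_distrib, ← Finset.sum_mul, hw, one_mul, map_smul, smul_eq_mul]

theorem bary_bary (t t' : M.Cell) (v : t'.1) (x : E3) :
    t'.bary v x = ∑ w, t.bary w x * t'.bary v (w : E3) := by
  conv_lhs => rw [← t.sum_bary_smul x]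
  exact t'.bary_sum v _ _ _ (t.sum_bary x)

theorem exists_opposite (t t' : M.Cell) (v : t.1) (hne : t ≠ t')
    (hf : ∀ a : t.1, a ≠ v → (a : E3) ∈ t'.1) :
    ∃ v' : t'.1, (v' : E3) ∉ t.1 ∧ ∀ a : t'.1, a ≠ v' → ∃ h : (a : E3) ∈ t.1, (⟨a, h⟩ : t.1) ≠ v := by
  have hcard : (t.1.erase v).card = 3 := by rw [Finset.card_erase_of_mem v.2, t.2.2]
  have hsub : t.1.erase v ⊆ t'.1 := fun a ha =>
    hf ⟨a, Finset.mem_of_mem_erase ha⟩ fun h => Finset.ne_of_mem_erase ha (congrArg Subtype.val h)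
  have hv : (v : E3) ∉ t'.1 := by
    intro hv
    refine hne (eq_of_card_inter t t' ?_)
    have : t.1 ⊆ t.1 ∩ t'.1 := fun a ha => Finset.mem_inter.2 ⟨ha, by
      by_cases h : a = v
      · exact h ▸ hv
      · exact hsub (Finset.mem_erase.2 ⟨h, ha⟩)⟩
    exact t.2.2.symm.le.trans (Finset.card_le_card this)
  have hd : (t'.1 \ t.1.erase v).card = 1 := by
    rw [Finset.card_sdiff_of_subset hsub, hcard, t'.2.2]
  obtain ⟨v', hv'⟩ := Finset.card_eq_one.1 hd
  have hmem : v' ∈ t'.1 \ t.1.erase v := hv' ▸ Finset.mem_singleton_self v'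
  rw [Finset.mem_sdiff] at hmem
  refine ⟨⟨v', hmem.1⟩, fun h => ?_, fun a ha => ?_⟩
  · by_cases hvv : v' = v
    · exact hv (hvv ▸ hmem.1)
    · exact hmem.2 (Finset.mem_erase.2 ⟨hvv, h⟩)
  · have : (a : E3) ∈ t.1.erase v := by
      by_contra hc
      have h1 : (a : E3) ∈ t'.1 \ t.1.erase v := Finset.mem_sdiff.2 ⟨a.2, hc⟩
      rw [hv', Finset.mem_singleton] at h1
      exact ha (Subtype.ext h1)
    exact ⟨Finset.mem_of_mem_erase this, fun h => Finset.ne_of_mem_erase this (congrArg Subtype.val h)⟩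

/-- The two cells lie on opposite sides of the common face, so near a relative interior point they
fill a ball. -/
theorem exists_ball_of_shared_face (t t' : M.Cell) (v : t.1) (hne : t ≠ t')
    (hf : ∀ a : t.1, a ≠ v → (a : E3) ∈ t'.1) {x₀ : E3} (h0 : t.bary v x₀ = 0)
    (hpos : ∀ a, a ≠ v → 0 < t.bary a x₀) :
    ∃ r > 0, ∀ x ∈ Metric.ball x₀ r,
      (0 ≤ t.bary v x → x ∈ t.body) ∧ (t.bary v x ≤ 0 → x ∈ t'.body) := by
  obtain ⟨v', hv', hopp⟩ := exists_opposite t t' v hne hf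
  -- Both coordinates are affine and vanish at the three shared vertices, so they are proportional.
  have hc : ∀ x, t'.bary v' x = t.bary v x * t'.bary v' (v : E3) := by
    intro x
    rw [bary_bary t t' v' x, Finset.sum_eq_single v]
    · intro w _ hw
      have : v' ≠ ⟨w, hf w hw⟩ := fun h => hv' (by rw [h]; exact w.2)
      rw [t'.bary_ne (w := ⟨w, hf w hw⟩) this, mul_zero]
    · simp
  have hpos' : ∀ a, a ≠ v' → 0 < t'.bary a x₀ := by
    intro a ha
    obtain ⟨hat, hav⟩ := hopp a ha
    rw [bary_bary t t' a x₀, Finset.sum_eq_single ⟨a, hat⟩]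
    · rw [t'.bary_self a, mul_one]
      exact hpos _ hav
    · intro w _ hw
      by_cases hwv : w = v
      · rw [hwv, h0, zero_mul]
      · have : a ≠ ⟨w, hf w hwv⟩ := fun h => hw (Subtype.ext (congrArg Subtype.val h).symm)
        rw [t'.bary_ne (w := ⟨w, hf w hwv⟩) this, mul_zero]
    · simp
  have hU : ∀ᶠ x in 𝓝 x₀, (∀ a, a ≠ v → 0 < t.bary a x) ∧ ∀ a, a ≠ v' → 0 < t'.bary a x := by
    refine Filter.Eventually.and ?_ ?_
    · refine eventually_all.2 fun a => ?_
      by_cases ha : a = v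
      · exact Eventually.of_forall fun x h => absurd ha h
      · filter_upwards [(t.continuous_bary a).continuousAt.eventually_const_lt (hpos a ha)] with x hx _
          using hx
    · refine eventually_all.2 fun a => ?_
      by_cases ha : a = v'
      · exact Eventually.of_forall fun x h => absurd ha h
      · filter_upwards [(t'.continuous_bary a).continuousAt.eventually_const_lt (hpos' a ha)] with x hx _
          using hx
  have hx₀ : x₀ ∈ closure (interior t.body) := by
    rw [closure_interior, mem_body]
    intro a
    by_cases ha : a = v
    · rw [ha, h0]
    · exact (hpos a ha).le
  -- With a positive factor, interior points of `t` close to `x₀` would lie in `t'`, against the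
  -- disjointness of distinct cells.
  have hneg : t'.bary v' (v : E3) ≤ 0 := by
    by_contra hcpos
    push Not at hcpos
    obtain ⟨y, ⟨hy1, hy2⟩, hyt⟩ := ((mem_closure_iff_frequently.1 hx₀).and_eventually hU).exists.imp
      fun y h => And.intro h.2 h.1
    have hyv := t.mem_interior_body.1 hyt v
    refine hne (eq_of_mem_interior t t' hyt (t'.mem_body.2 fun a => ?_))
    by_cases ha : a = v'
    · rw [ha, hc]; positivity
    · exact (hy2 a ha).le
  obtain ⟨r, hr, hb⟩ := Metric.eventually_nhds_iff_ball.1 hU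
  refine ⟨r, hr, fun x hx => ⟨fun h => t.mem_body.2 fun a => ?_, fun h => t'.mem_body.2 fun a => ?_⟩⟩
  · by_cases ha : a = v
    · rwa [ha]
    · exact ((hb x hx).1 a ha).le
  · by_cases ha : a = v'
    · rw [ha, hc]
      exact mul_nonneg_of_nonpos_of_nonpos h hneg
    · exact ((hb x hx).2 a ha).le

/-- The supports of the cutoffs shrink to the null plane `λ_v = 0`; dominated convergence applies.
-/
theorem tendsto_integral_cutoff (t : M.Cell) (v : t.1) {μ : Measure E3} (hμ : μ ≪ volume)
    {k : E3 → ℝ} (hk : Integrable k μ) :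
    Tendsto (fun n : ℕ => ∫ x, cutoff (n * t.bary v x) * k x ∂μ) atTop (𝓝 0) := by
  have hlim : Tendsto (fun n : ℕ => ∫ x, cutoff (n * t.bary v x) * k x ∂μ) atTop
      (𝓝 (∫ _, (0 : ℝ) ∂μ)) := by
    refine tendsto_integral_of_dominated_convergence (fun x => ‖k x‖) ?_ hk.norm ?_ ?_
    · intro n
      refine AEStronglyMeasurable.mul (Continuous.aestronglyMeasurable ?_) hk.1
      exact (contDiff_cutoff (n := 0)).continuous.comp (continuous_const.mul (t.continuous_bary v))
    · intro n
      refine Eventually.of_forall fun x => ?_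
      rw [norm_mul, Real.norm_eq_abs, abs_of_nonneg (cutoff_nonneg _)]
      exact mul_le_of_le_one_left (norm_nonneg _) (cutoff_le_one _)
    · filter_upwards [hμ.ae_le (t.ae_bary_ne_zero v)] with x hx
      refine tendsto_const_nhds.congr' ?_
      have hpos := abs_pos.2 hx
      obtain ⟨N, hN⟩ := exists_nat_ge (2 / |t.bary v x|)
      filter_upwards [eventually_ge_atTop N] with n hn
      rw [cutoff_eq_zero, zero_mul]
      rw [abs_mul, Nat.abs_cast, ← div_le_iff₀ hpos]
      exact hN.trans (by exact_mod_cast hn)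
  simpa using hlim

theorem fderiv_cutoff_mul (t : M.Cell) (v : t.1) (n : ℕ) {ρ : E3 → ℝ} {x : E3}
    (hρ : DifferentiableAt ℝ ρ x) (y : E3) :
    fderiv ℝ (fun x => cutoff (n * t.bary v x) * ρ x) x y =
      (n * deriv cutoff (n * t.bary v x)) * (ρ x * t.grad v y) +
        cutoff (n * t.bary v x) * fderiv ℝ ρ x y := by
  have h1 : HasFDerivAt (fun x => (n : ℝ) * t.bary v x) ((n : ℝ) • t.grad v) x :=
    (t.hasFDerivAt_bary v x).const_mul _
  have h2 : HasDerivAt cutoff (deriv cutoff (n * t.bary v x)) (n * t.bary v x) :=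
    ((contDiff_cutoff (n := 1)).differentiable (by simp) _).hasDerivAt
  have h3 : HasFDerivAt (fun x => cutoff (n * t.bary v x))
      (deriv cutoff (n * t.bary v x) • (n : ℝ) • t.grad v) x := by
    have := h2.comp_hasFDerivAt x h1
    exact this
  rw [(h3.fun_mul hρ.hasFDerivAt).fderiv]
  simp
  ring

/-- The weak curl is tested with `cutoff(n λ_v) ρ a`. All terms in which the cutoff is not
differentiated tend to zero. What remains is the concentrated integral of `∇λ_v · (a × jump)` on one
side of the face, so this quantity vanishes at `x₀`. -/
theorem grad_cr_jump_eq_zero (t t' : M.Cell) (v : t.1) (hne : t ≠ t')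
    (hf : ∀ a : t.1, a ≠ v → (a : E3) ∈ t'.1) {w : L2v M.domain} (hw : w ∈ Hcurl M.domain)
    {P : M.Cell → Fin 3 → Poly} (hP : ∀ t : M.Cell, w =ᵐ[t.vol] evv (P t)) {x₀ : E3}
    (h0 : t.bary v x₀ = 0) (hpos : ∀ a, a ≠ v → 0 < t.bary a x₀) (a : E3) :
    t.grad v (cr a (evv (P t) x₀ - evv (P t') x₀)) = 0 := by
  obtain ⟨r, hr, hball⟩ := exists_ball_of_shared_face t t' v hne hf h0 hpos
  obtain ⟨g, hg⟩ := hw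
  have hbΩ : Metric.ball x₀ r ⊆ M.domain := by
    refine interior_maximal (fun x hx => ?_) Metric.isOpen_ball
    rcases le_total 0 (t.bary v x) with h | h
    · exact t.body_subset ((hball x hx).1 h)
    · exact t'.body_subset ((hball x hx).2 h)
  have hℓ : ∀ x, t.grad v (x - x₀) = t.bary v x := fun x => by
    rw [t.bary_eq v x x₀, h0, add_zero]
  set D : Fin 3 → Poly := crPoly a (P t - P t') with hD
  have hDe : ∀ x, evv D x = cr a (evv (P t) x - evv (P t') x) := fun x => by
    rw [hD, evv_crPoly, evv_sub]
  set Q : Fin 3 → Poly := crPoly a (P t') with hQ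
  have hQe : ∀ x, evv Q x = cr a (evv (P t') x) := fun x => by rw [hQ, evv_crPoly]
  have hcradd : ∀ b c : E3, cr a (b + c) = cr a b + cr a c := by
    intro b c
    ext i
    fin_cases i <;> simp [cr] <;> ring
  rw [← hDe]
  refine eq_zero_of_concentrated_integral_tendsto (t.grad_ne_zero v) hr
    (G := fun x => t.grad v (evv D x)) ((t.grad v).continuous.comp (continuous_evv D)) ?_
  intro ρ hρ hρc hρs
  simp only [hℓ]
  have hρd := hρ.differentiable (by simp)
  set S : Set E3 := {x | 0 ≤ t.bary v x} with hS
  have hSm : MeasurableSet S := (isClosed_le continuous_const (t.continuous_bary v)).measurableSet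
  let ψ : ℕ → E3 → ℝ := fun n x => cutoff (n * t.bary v x) * ρ x
  have hcs : ∀ n : ℕ, ContDiff ℝ ∞ fun x => cutoff (n * t.bary v x) := fun n =>
    contDiff_cutoff.comp (contDiff_const.mul (t.contDiff_bary v))
  have hψ : ∀ n, ContDiff ℝ ∞ (ψ n) := fun n => (hcs n).mul hρ
  have hψc : ∀ n, HasCompactSupport (ψ n) := fun n => hρc.mul_left
  have hψs : ∀ n, tsupport (ψ n) ⊆ tsupport ρ := fun n => closure_mono fun x hx => by
    rw [Function.mem_support] at hx ⊢
    exact right_ne_zero_of_mul hx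
  have hψ0 : ∀ n x, x ∉ tsupport ρ → fderiv ℝ (ψ n) x = 0 := fun n x hx =>
    image_eq_zero_of_notMem_tsupport fun h => hx (hψs n (tsupport_fderiv_subset ℝ h))
  have hφ : ∀ n, IsTest M.domain fun x => ψ n x • a := by
    intro n
    have hsub : tsupport (fun x => ψ n x • a) ⊆ tsupport (ψ n) := closure_mono fun x hx => by
      rw [Function.mem_support] at hx ⊢
      exact left_ne_zero_of_smul hx
    exact ⟨(hψ n).smul contDiff_const, (hψc n).mono' (subset_closure.trans hsub),
      hsub.trans ((hψs n).trans (hρs.trans hbΩ))⟩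
  have hDi : ∀ n, Integrable fun x => fderiv ℝ (ψ n) x (evv D x) := fun n =>
    Continuous.integrable_of_hasCompactSupport
      (((hψ n).continuous_fderiv (by simp)).clm_apply (continuous_evv D))
      (HasCompactSupport.intro hρc fun x hx => by rw [hψ0 n x hx]; rfl)
  have hQi : ∀ n, Integrable fun x => fderiv ℝ (ψ n) x (evv Q x) := fun n =>
    Continuous.integrable_of_hasCompactSupport
      (((hψ n).continuous_fderiv (by simp)).clm_apply (continuous_evv Q))
      (HasCompactSupport.intro hρc fun x hx => by rw [hψ0 n x hx]; rfl)
  -- On the ball, `w` is the single polynomial field `P t'` plus the jump restricted to `λ_v ≥ 0`.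
  -- The first summand is smooth across the face and can be integrated by parts over the whole
  -- space.
  have hsplit : ∀ n, ∫ x in M.domain, inner ℝ (w x) (curl (fun y => ψ n y • a) x) =
      (∫ x in S, fderiv ℝ (ψ n) x (evv D x)) + ∫ x, fderiv ℝ (ψ n) x (evv Q x) := by
    intro n
    rw [← integral_indicator hSm, ← integral_add ((hDi n).indicator hSm) (hQi n)]
    refine Eq.trans (integral_congr_ae (ae_domain fun s => ?_))
      (setIntegral_eq_integral_of_forall_compl_eq_zero (s := M.domain) fun x hx => ?_)
    · have hmem : ∀ᵐ x ∂s.vol, x ∈ interior s.body := by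
        rw [s.vol_eq]; exact ae_restrict_mem isOpen_interior.measurableSet
      filter_upwards [hP s, hmem] with x hx hxs
      rw [inner_curl_smul_const _ _ ((hψ n).differentiable (by simp) x)]
      by_cases hxρ : x ∈ tsupport ρ
      · by_cases hxS : 0 ≤ t.bary v x
        · have hst : s = t := eq_of_mem_interior s t hxs ((hball x (hρs hxρ)).1 hxS)
          rw [Set.indicator_of_mem (show x ∈ S from hxS), ← map_add, hDe, hQe, ← hcradd,
            sub_add_cancel, hx, hst]
        · have hst : s = t' := eq_of_mem_interior s t' hxs ((hball x (hρs hxρ)).2 (not_le.1 hxS).le)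
          rw [Set.indicator_of_notMem (show x ∉ S from hxS), zero_add, hQe, hx, hst]
      · rw [hψ0 n x hxρ]
        simp [Set.indicator, hψ0 n x hxρ]
    · have hxρ : x ∉ tsupport ρ := fun h => hx (hbΩ (hρs h))
      simp [Set.indicator, hψ0 n x hxρ]
  have hmain : ∀ n : ℕ, ∫ x in S, (n * deriv cutoff (n * t.bary v x)) * (ρ x * t.grad v (evv D x)) =
      (∫ x in M.domain, cutoff (n * t.bary v x) * inner ℝ (g x) (ρ x • a)) +
      (∫ x, cutoff (n * t.bary v x) * (ev (∑ j, pderiv j (Q j)) x * ρ x)) -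
      ∫ x in S, cutoff (n * t.bary v x) * fderiv ℝ ρ x (evv D x) := by
    intro n
    have h1 := hg _ (hφ n)
    rw [hsplit n, integral_fderiv_evv Q (hψ n) (hψc n)] at h1
    have h2 : ∫ x in S, fderiv ℝ (ψ n) x (evv D x) =
        (∫ x in S, (n * deriv cutoff (n * t.bary v x)) * (ρ x * t.grad v (evv D x))) +
          ∫ x in S, cutoff (n * t.bary v x) * fderiv ℝ ρ x (evv D x) := by
      rw [← integral_add]
      · exact integral_congr_ae (Eventually.of_forall fun x => t.fderiv_cutoff_mul v n (hρd x) _)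
      · refine (Continuous.integrable_of_hasCompactSupport ?_ ?_).restrict
        · exact (continuous_const.mul (continuous_deriv_cutoff.comp
            (continuous_const.mul (t.continuous_bary v)))).mul
            (hρ.continuous.mul ((t.grad v).continuous.comp (continuous_evv D)))
        · exact HasCompactSupport.mul_left (hρc.mul_right)
      · refine (Continuous.integrable_of_hasCompactSupport ?_ ?_).restrict
        · exact (hcs n).continuous.mul ((hρ.continuous_fderiv (by simp)).clm_apply (continuous_evv D))
        · exact HasCompactSupport.intro hρc fun x hx => by
            rw [image_eq_zero_of_notMem_tsupport fun h => hx (tsupport_fderiv_subset ℝ h)]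
            simp
    have h3 : ∫ x in M.domain, inner ℝ (g x) (ψ n x • a) =
        ∫ x in M.domain, cutoff (n * t.bary v x) * inner ℝ (g x) (ρ x • a) := by
      refine integral_congr_ae (Eventually.of_forall fun x => ?_)
      simp only [ψ, inner_smul_right, mul_assoc]
    have h4 : ∫ x, ev (∑ j, pderiv j (Q j)) x * ψ n x =
        ∫ x, cutoff (n * t.bary v x) * (ev (∑ j, pderiv j (Q j)) x * ρ x) := by
      refine integral_congr_ae (Eventually.of_forall fun x => ?_)
      simp only [ψ]
      ring
    rw [h2, h3, h4] at h1
    linarith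
  have hac : volume.restrict M.domain ≪ (volume : Measure E3) :=
    Measure.absolutelyContinuous_of_le Measure.restrict_le_self
  have hac' : volume.restrict S ≪ (volume : Measure E3) :=
    Measure.absolutelyContinuous_of_le Measure.restrict_le_self
  have l1 := t.tendsto_integral_cutoff v hac (k := fun x => inner ℝ (g x) (ρ x • a))
    (integrable_inner_test g (ψ := fun x => ρ x • a) (hρ.continuous.smul continuous_const)
      hρc.smul_right)
  have l2 := t.tendsto_integral_cutoff v (μ := volume) Measure.AbsolutelyContinuous.rfl
    (k := fun x => ev (∑ j, pderiv j (Q j)) x * ρ x)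
    (((continuous_ev _).mul hρ.continuous).integrable_of_hasCompactSupport hρc.mul_left)
  have l3 := t.tendsto_integral_cutoff v hac' (k := fun x => fderiv ℝ ρ x (evv D x))
    (Continuous.integrable_of_hasCompactSupport
      ((hρ.continuous_fderiv (by simp)).clm_apply (continuous_evv D))
      (HasCompactSupport.intro hρc fun x hx => by
        rw [image_eq_zero_of_notMem_tsupport fun h => hx (tsupport_fderiv_subset ℝ h)]; rfl)).restrict
  have := (l1.add l2).sub l3
  rw [add_zero, sub_zero] at this
  exact this.congr fun n => (hmain n).symm

theorem jump_eq_smul_normal (t t' : M.Cell) (v : t.1) (hne : t ≠ t')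
    (hf : ∀ a : t.1, a ≠ v → (a : E3) ∈ t'.1) {w : L2v M.domain} (hw : w ∈ Hcurl M.domain)
    {P : M.Cell → Fin 3 → Poly} (hP : ∀ t : M.Cell, w =ᵐ[t.vol] evv (P t)) {ν : E3}
    (hν : t.IsUnitNormal v ν) {x : E3} (hx : x ∈ t.body) (h0 : t.bary v x = 0) :
    evv (P t) x - evv (P t') x = (inner ℝ ν (evv (P t) x - evv (P t') x) : ℝ) • ν := by
  classical
  have hopen : ∀ y, t.bary v y = 0 → (∀ a, a ≠ v → 0 < t.bary a y) →
      evv (P t) y - evv (P t') y = (inner ℝ ν (evv (P t) y - evv (P t') y) : ℝ) • ν := by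
    intro y hy hya
    refine eq_smul_of_inner_cr_eq_zero hν.1 fun a => ?_
    exact (t.grad_eq_zero_iff hν _).1 (t.grad_cr_jump_eq_zero t' v hne hf hw hP hy hya a)
  -- The barycentre of the face. Points of the segment from `x` towards it are relatively interior,
  -- so the identity reaches the edges and vertices of the face by continuity.
  let c : E3 := ∑ w ∈ Finset.univ.erase v, (3⁻¹ : ℝ) • (w : E3)
  have hc : ∀ a, t.bary a c = ∑ w ∈ Finset.univ.erase v, (3⁻¹ : ℝ) * t.bary a (w : E3) := fun a =>
    t.bary_sum a _ _ _ (by rw [Finset.sum_const, card_erase]; norm_num)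
  have hcv : t.bary v c = 0 := by
    rw [hc]
    exact Finset.sum_eq_zero fun w hw => by
      rw [t.bary_ne (Finset.ne_of_mem_erase hw).symm, mul_zero]
  have hca : ∀ a, a ≠ v → 0 < t.bary a c := by
    intro a ha
    rw [hc, Finset.sum_eq_single_of_mem a (Finset.mem_erase.2 ⟨ha, Finset.mem_univ a⟩)]
    · rw [bary_self]; norm_num
    · intro w _ hw
      rw [t.bary_ne hw.symm, mul_zero]
  let γ : ℝ → E3 := fun s => x + s • (c - x)
  have hγ : Continuous γ := by fun_prop
  have hbγ : ∀ a s, t.bary a (γ s) = (1 - s) * t.bary a x + s * t.bary a c := by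
    intro a s
    have := t.bary_eq a c x
    simp only [γ]
    rw [bary_add, map_smul, smul_eq_mul]
    linear_combination (-s) * this
  let K : E3 → E3 := fun y => evv (P t) y - evv (P t') y -
    (inner ℝ ν (evv (P t) y - evv (P t') y) : ℝ) • ν
  have hK : Continuous K := by
    have h1 : Continuous fun y => evv (P t) y - evv (P t') y :=
      (continuous_evv _).sub (continuous_evv _)
    exact h1.sub (Continuous.fun_smul (continuous_const.inner h1) continuous_const)
  have hlim : Tendsto (fun s => K (γ s)) (𝓝[>] 0) (𝓝 (K (γ 0))) :=
    (hK.comp hγ).continuousAt.tendsto.mono_left nhdsWithin_le_nhds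
  have hzero : ∀ᶠ s in 𝓝[>] (0 : ℝ), K (γ s) = 0 := by
    filter_upwards [Ioo_mem_nhdsGT one_pos] with s hs
    refine sub_eq_zero.2 (hopen _ ?_ fun a ha => ?_)
    · rw [hbγ, h0, hcv]; ring
    · rw [hbγ]
      have h1 := t.mem_body.1 hx a
      have h2 := hca a ha
      have h3 : 0 ≤ 1 - s := by linarith [hs.2]
      have := hs.1
      positivity
  have hK0 : K (γ 0) = 0 :=
    tendsto_nhds_unique hlim (tendsto_const_nhds.congr' (hzero.mono fun s hs => hs.symm))
  have : γ 0 = x := by simp [γ]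
  rw [this] at hK0
  exact sub_eq_zero.1 hK0

end Cell

end TetMesh
-- Removing the jumps by bubbles
namespace TetMesh

open Filter Topology MvPolynomial

variable {M : TetMesh}

namespace Cell

/-- The normalised gradient of `λ_v`, which is constant on the opposite face. -/
theorem exists_isUnitNormal (t : M.Cell) (v : t.1) : ∃ ν, t.IsUnitNormal v ν := by
  set y := (InnerProductSpace.toDual ℝ E3).symm (t.grad v) with hy
  have hin : ∀ x, inner ℝ y x = t.grad v x := fun x => by
    rw [hy, InnerProductSpace.toDual_symm_apply]
  have hy0 : ‖y‖ ≠ 0 := by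
    rw [norm_ne_zero_iff]
    intro h
    refine t.grad_ne_zero v (ContinuousLinearMap.ext fun x => ?_)
    rw [← hin, h, inner_zero_left]
    rfl
  refine ⟨‖y‖⁻¹ • y, ?_, fun a b ha hb => ?_⟩
  · rw [norm_smul, norm_inv, norm_norm, inv_mul_cancel₀ hy0]
  · have := t.bary_eq v (a : E3) (b : E3)
    rw [t.bary_ne ha.symm, t.bary_ne hb.symm, add_zero] at this
    rw [inner_smul_left, hin, ← this, mul_zero]

/-- The jump on the face is `Q ν` with `Q = ν · (P t - P r)`, and edge continuity makes `Q` vanish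
on the sides of the face. Hence it is the trace of a bubble, which is zero on the other faces. The
case `t = r`, a cell being its own reference, needs no correction. -/
theorem exists_face_correction (t r : M.Cell) (v : t.1) (hr : ∀ a : t.1, a ≠ v → (a : E3) ∈ r.1)
    {p : ℕ} {w : L2v M.domain} (hw : w ∈ Hcurl M.domain) {P : M.Cell → Fin 3 → Poly}
    (hdeg : ∀ t i, P t i ∈ restrictTotalDegree (Fin 3) ℝ p) (hP : ∀ t : M.Cell, w =ᵐ[t.vol] evv (P t))
    (hedge : ∀ t t' : M.Cell, ∀ e ⊆ t.1, e ⊆ t'.1 → e.card = 2 →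
      ∀ x ∈ convexHull ℝ (e : Set E3), evv (P t) x = evv (P t') x) :
    ∃ B, t.IsBubble p B ∧ evv B ∈ t.bubble p ∧
      (∀ x ∈ t.body, t.bary v x = 0 → evv B x = evv (P t) x - evv (P r) x) ∧
      ∀ x, ∀ a, a ≠ v → t.bary a x = 0 → evv B x = 0 := by
  classical
  have hz : evv 0 ∈ t.bubble p := by
    rw [funext evv_zero]; exact zero_mem _
  by_cases hne : t = r
  · subst hne
    exact ⟨0, .zero t p, hz, fun x _ _ => by rw [evv_zero, sub_self], fun x _ _ _ => evv_zero x⟩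
  obtain ⟨ν, hν⟩ := t.exists_isUnitNormal v
  have hjump := fun x hx h0 => t.jump_eq_smul_normal r v hne hr hw hP hν (x := x) hx h0
  set Q : Poly := ∑ i, ν i • (P t i - P r i) with hQ
  have hQe : ∀ x, ev Q x = inner ℝ ν (evv (P t) x - evv (P r) x) := by
    intro x
    rw [hQ, ← evv_sub, PiLp.inner_apply, ev, map_sum]
    refine Finset.sum_congr rfl fun i _ => ?_
    simp [evv, ev, mul_comm]
  have hQd : Q.totalDegree ≤ p := by
    rw [← mem_restrictTotalDegree]
    exact Submodule.sum_mem _ fun i _ => Submodule.smul_mem _ _ (sub_mem (hdeg t i) (hdeg r i))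
  have hQ0 : ∀ a b : t.1, a ≠ v → b ≠ v → a ≠ b → ∀ x ∈ convexHull ℝ {(a : E3), (b : E3)},
      ev Q x = 0 := by
    intro a b ha hb hab x hx
    have hab' : (a : E3) ≠ b := fun h => hab (Subtype.ext h)
    have := hedge t r {(a : E3), (b : E3)} (by simp [Finset.insert_subset_iff])
      (by simp [Finset.insert_subset_iff, hr a ha, hr b hb]) (Finset.card_pair hab') x
      (by simpa using hx)
    rw [hQe, this, sub_self, inner_zero_right]
  rcases t.exists_face_bubble v Q hQd hQ0 with h | ⟨q, hq, h⟩
  · refine ⟨0, .zero t p, hz, fun x hx h0 => ?_, fun x _ _ _ => evv_zero x⟩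
    rw [hjump x hx h0, ← hQe, h x h0, zero_smul, evv_zero]
  · refine ⟨fun i => ν i • t.bubblePoly v q, t.isBubble_bubblePoly hν hq, ?_, fun x hx h0 => ?_,
      fun x a ha h0 => ?_⟩
    · refine Submodule.mem_iSup_of_mem v (Submodule.subset_span ⟨q, ν, hq, hν, ?_⟩)
      exact t.evv_smul_bubblePoly v ν q
    · rw [hjump x hx h0, ← hQe, h x h0, evv_smul_bubblePoly]
    · rw [evv_smul_bubblePoly]
      simp only
      rw [Finset.prod_eq_zero (Finset.mem_erase.2 ⟨ha, Finset.mem_univ a⟩) h0, mul_zero, zero_smul]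

theorem IsBubble.sum {t : M.Cell} {p : ℕ} {ι : Type*} (s : Finset ι) {B : ι → Fin 3 → Poly}
    (h : ∀ i ∈ s, t.IsBubble p (B i)) : t.IsBubble p (∑ i ∈ s, B i) := by
  classical
  induction s using Finset.induction_on with
  | empty => exact .zero t p
  | insert a s ha ih =>
    rw [Finset.sum_insert ha]
    exact (h a (Finset.mem_insert_self a s)).add (ih fun i hi => h i (Finset.mem_insert_of_mem hi))

theorem evv_sum {ι : Type*} (s : Finset ι) (B : ι → Fin 3 → Poly) (x : E3) :
    evv (∑ i ∈ s, B i) x = ∑ i ∈ s, evv (B i) x := by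
  classical
  induction s using Finset.induction_on with
  | empty => exact evv_zero x
  | insert a s ha ih => rw [Finset.sum_insert ha, Finset.sum_insert ha, evv_add, ih]

theorem IsBubble.eq_zero_of_mem_convexHull {t : M.Cell} {p : ℕ} {B : Fin 3 → Poly}
    (hB : t.IsBubble p B) {s : Finset E3} (hs : s ⊆ t.1) (hc : s.card ≤ 2) {x : E3}
    (hx : x ∈ convexHull ℝ (s : Set E3)) : evv B x = 0 := by
  have hcard : 1 < (t.1 \ s).card := by
    rw [Finset.card_sdiff_of_subset hs, t.2.2]; omega
  obtain ⟨a, ha, b, hb, hab⟩ := Finset.one_lt_card.1 hcard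
  rw [Finset.mem_sdiff] at ha hb
  have h0 : ∀ c : t.1, (c : E3) ∉ s → t.bary c x = 0 := fun c hc =>
    t.bary_eq_zero_of_mem (by exact_mod_cast hs) hx c (by exact_mod_cast hc)
  exact hB.edge x ⟨a, ha.1⟩ ⟨b, hb.1⟩ (fun h => hab (congrArg Subtype.val h))
    (h0 _ ha.2) (h0 _ hb.2)

end Cell

/-- Two neighbours are not compared directly: each is adjusted to a reference cell of the common
face. The corrections of different faces do not interfere, since each vanishes on the other faces of
its cell. -/
theorem exists_decomposition {p : ℕ} {w : L2v M.domain} (hw : w ∈ Hcurl M.domain)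
    {P : M.Cell → Fin 3 → Poly} (hdeg : ∀ t i, P t i ∈ restrictTotalDegree (Fin 3) ℝ p)
    (hP : ∀ t : M.Cell, w =ᵐ[t.vol] evv (P t))
    (hvert : ∀ t t' : M.Cell, ∀ x ∈ t.1, x ∈ t'.1 → ∀ i, AgreeC1 (P t i) (P t' i) x)
    (hedge : ∀ t t' : M.Cell, ∀ e ⊆ t.1, e ⊆ t'.1 → e.card = 2 →
      ∀ x ∈ convexHull ℝ (e : Set E3), evv (P t) x = evv (P t') x) :
    ∃ B : M.Cell → Fin 3 → Poly, (∀ t : M.Cell, t.IsBubble p (B t)) ∧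
      (∀ t : M.Cell, evv (B t) ∈ t.bubble p) ∧
      ∀ t t' : M.Cell, ∀ x ∈ t.body, x ∈ t'.body → evv (P t - B t) x = evv (P t' - B t') x := by
  classical
  -- Choosing here makes `ref` a function of the vertex set alone, up to proof irrelevance, so both
  -- cells at a face obtain the same reference.
  have href : ∀ s : Finset E3, (∃ r : M.Cell, s ⊆ r.1) → ∃ r : M.Cell, s ⊆ r.1 := fun s h => h
  choose ref hsub using href
  have hmem : ∀ (t : M.Cell) (v : t.1), ∃ r : M.Cell, t.1.erase v ⊆ r.1 := fun t v =>
    ⟨t, Finset.erase_subset _ _⟩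
  have hr : ∀ (t : M.Cell) (v : t.1), ∀ a : t.1, a ≠ v → (a : E3) ∈ (ref _ (hmem t v)).1 :=
    fun t v a ha => hsub _ (hmem t v) (Finset.mem_erase.2 ⟨fun h => ha (Subtype.ext h), a.2⟩)
  choose B hB hBm hface hoff using fun (t : M.Cell) (v : t.1) =>
    t.exists_face_correction (ref _ (hmem t v)) v (hr t v) hw hdeg hP hedge
  have hBB : ∀ t : M.Cell, t.IsBubble p (∑ v, B t v) := fun t => Cell.IsBubble.sum _ fun v _ => hB t v
  refine ⟨fun t => ∑ v, B t v, hBB, fun t => ?_, ?_⟩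
  · have : evv (∑ v, B t v) = ∑ v, evv (B t v) := by
      ext1 x; rw [Cell.evv_sum, Finset.sum_apply]
    rw [this]
    exact Submodule.sum_mem _ fun v _ => hBm t v
  -- After the correction, the trace on a face is that of the reference cell.
  have hS : ∀ (t : M.Cell) (v : t.1), ∀ x ∈ t.body, t.bary v x = 0 →
      evv (P t - ∑ v, B t v) x = evv (P (ref _ (hmem t v))) x := by
    intro t v x hx h0
    rw [evv_sub, Cell.evv_sum, Finset.sum_eq_single v, hface t v x hx h0, sub_sub_cancel]
    · intro u _ hu
      exact hoff t u x v hu.symm h0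
    · simp
  intro t t' x hx hx'
  by_cases hne : t = t'
  · rw [hne]
  have hconv := Cell.inter_body t t' hx hx'
  have hlt : (t.1 ∩ t'.1 : Finset E3).card < 4 := by
    by_contra hc
    exact hne (Cell.eq_of_card_inter t t' (not_lt.1 hc))
  have hl : (t.1 ∩ t'.1 : Finset E3) ⊆ t.1 := Finset.inter_subset_left
  have hr' : (t.1 ∩ t'.1 : Finset E3) ⊆ t'.1 := Finset.inter_subset_right
  generalize hs : (t.1 ∩ t'.1 : Finset E3) = s at hconv hlt hl hr'
  by_cases h3 : s.card = 3
  · have key : ∀ u : M.Cell, s ⊆ u.1 → x ∈ u.body →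
        evv (P u - ∑ v, B u v) x = evv (P (ref s ⟨t, hl⟩)) x := by
      intro u hu hxu
      have hd : (u.1 \ s).card = 1 := by rw [Finset.card_sdiff_of_subset hu, u.2.2, h3]
      obtain ⟨v, hv⟩ := Finset.card_eq_one.1 hd
      have hvu : v ∈ u.1 \ s := hv ▸ Finset.mem_singleton_self v
      rw [Finset.mem_sdiff] at hvu
      have he : u.1.erase v = s := by
        rw [Finset.erase_eq, ← hv, Finset.sdiff_sdiff_eq_self hu]
      have h0 : u.bary ⟨v, hvu.1⟩ x = 0 :=
        u.bary_eq_zero_of_mem (by exact_mod_cast hu) hconv _ (by exact_mod_cast hvu.2)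
      rw [hS u ⟨v, hvu.1⟩ x hxu h0]
      simp only [he]
    rw [key t hl hx, key t' hr' hx']
  -- On a common edge or vertex all bubbles vanish, and the agreement of the original pieces
  -- suffices.
  · have hc : s.card ≤ 2 := by omega
    rw [evv_sub, evv_sub, (hBB t).eq_zero_of_mem_convexHull hl hc hconv,
      (hBB t').eq_zero_of_mem_convexHull hr' hc hconv]
    congr 1
    by_cases h2 : s.card = 2
    · exact hedge t t' s hl hr' h2 x hconv
    · by_cases h1 : s.card = 1
      · obtain ⟨y, rfl⟩ := Finset.card_eq_one.1 h1
        rw [Finset.coe_singleton, convexHull_singleton, Set.mem_singleton_iff] at hconv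
        subst hconv
        ext i
        exact (hvert t t' x (hl (by simp)) (hr' (by simp)) i).1
      · have : s = ∅ := Finset.card_eq_zero.1 (by omega)
        rw [this] at hconv
        simp at hconv

/-! ### The two inclusions in `L²`, and the restrictions to a cell -/

theorem exists_continuous_glue (q : M.Cell → Poly)
    (hq : ∀ t t' : M.Cell, ∀ x ∈ t.body, x ∈ t'.body → ev (q t) x = ev (q t') x) :
    ∃ f : E3 → ℝ, ContinuousOn f M.closedDomain ∧ ∀ t, Set.EqOn f (ev (q t)) t.body := by
  classical
  let f : E3 → ℝ := fun x => if h : ∃ t : M.Cell, x ∈ t.body then ev (q h.choose) x else 0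
  have hf : ∀ t, Set.EqOn f (ev (q t)) t.body := by
    intro t x hx
    have h : ∃ t : M.Cell, x ∈ t.body := ⟨t, hx⟩
    simp only [f, dif_pos h]
    exact hq _ _ x h.choose_spec hx
  refine ⟨f, ?_, hf⟩
  rw [closedDomain_eq]
  exact (locallyFinite_of_finite _).continuousOn_iUnion (fun t => t.isClosed_body) fun t =>
    (continuous_ev (q t)).continuousOn.congr (hf t)

theorem ae_vol_of_ae {t : M.Cell} {q : E3 → Prop} (h : ∀ᵐ x ∂(volume.restrict M.domain), q x) :
    ∀ᵐ x ∂t.vol, q x := ae_restrict_of_ae h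

theorem mem_hermite_of_piecewise {p : ℕ} (q : M.Cell → Poly)
    (hdeg : ∀ t, q t ∈ restrictTotalDegree (Fin 3) ℝ p)
    (hq : ∀ t t' : M.Cell, ∀ x ∈ t.body, x ∈ t'.body → ev (q t) x = ev (q t') x)
    (hvert : ∀ t t' : M.Cell, ∀ x ∈ t.1, x ∈ t'.1 → AgreeC1 (q t) (q t') x) {s : L2s M.domain}
    (hs : ∀ t : M.Cell, s =ᵐ[t.vol] ev (q t)) : s ∈ M.hermite p := by
  obtain ⟨f, hfc, hf⟩ := exists_continuous_glue q hq
  refine ⟨mem_H1_of_piecewise q f hf s hs, ⟨f, hfc, ?_⟩, q, hdeg, hs, hvert⟩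
  refine ae_domain fun t => ?_
  have hmem : ∀ᵐ x ∂t.vol, x ∈ interior t.body := by
    rw [t.vol_eq]; exact ae_restrict_mem isOpen_interior.measurableSet
  filter_upwards [hs t, hmem] with x hx hxt
  rw [hx, hf t (interior_subset hxt)]

/-- The components of a field in `L²`. -/
def comp (i : Fin 3) (w : L2v M.domain) : L2s M.domain :=
  (EuclideanSpace.proj i : E3 →L[ℝ] ℝ).compLpL 2 (volume.restrict M.domain) w

theorem comp_ae (i : Fin 3) (w : L2v M.domain) :
    comp i w =ᵐ[volume.restrict M.domain] fun x => w x i :=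
  (EuclideanSpace.proj i : E3 →L[ℝ] ℝ).coeFn_compLpL w

theorem mem_vectorHermite {p : ℕ} {w : L2v M.domain} :
    w ∈ M.vectorHermite p ↔ ∀ i, comp i w ∈ M.hermite p := by
  simp only [vectorHermite, Submodule.mem_iInf]
  rfl

theorem mem_globalBubble {p : ℕ} {w : L2v M.domain} :
    w ∈ M.globalBubble p ↔ ∀ t : M.Cell, ∃ f ∈ t.bubble p, w =ᵐ[t.vol] f := by
  simp only [globalBubble, Submodule.mem_iInf]
  refine forall_congr' fun t => ?_
  have h : t.restr w =ᵐ[t.vol] w := LpToLpRestrictCLM_coeFn ℝ t.body w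
  constructor
  · rintro ⟨f, hf, hw⟩
    exact ⟨f, hf, h.symm.trans hw⟩
  · rintro ⟨f, hf, hw⟩
    exact ⟨f, hf, h.trans hw⟩

theorem P2Λ1_le (p : ℕ) : M.P2Λ1 p ≤ M.vectorHermite p ⊔ M.globalBubble p := by
  rintro w ⟨hw, P, hdeg, hP, hvert, hedge⟩
  obtain ⟨B, hB, hBm, hagree⟩ := exists_decomposition hw hdeg hP hvert hedge
  refine Submodule.mem_sup.2 ⟨glueL2 (fun t : M.Cell => evv (P t - B t)) fun t => continuous_evv _, ?_,
    glueL2 (fun t : M.Cell => evv (B t)) fun t => continuous_evv _, ?_, ?_⟩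
  · refine mem_vectorHermite.2 fun i => ?_
    refine mem_hermite_of_piecewise (fun t => P t i - B t i) (fun t => sub_mem (hdeg t i)
      ((hB t).degree i)) (fun t t' x hx hx' => ?_) (fun t t' x hx hx' => ?_) fun t => ?_
    · exact congrArg (fun y : E3 => y i) (hagree t t' x hx hx')
    -- Bubbles vanish to first order at the vertices, so the remainder keeps the first order data of
    -- the original pieces.
    · have h := hvert t t' x hx hx' i
      have h1 := (hB t).vertex i x hx
      have h2 := (hB t').vertex i x hx'
      refine ⟨?_, fun j => ?_⟩
      · rw [ev_sub, ev_sub, h.1, h1.1, h2.1]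
      · rw [map_sub, map_sub, ev_sub, ev_sub, h.2 j, h1.2 j, h2.2 j]
    · filter_upwards [ae_vol_of_ae (comp_ae i _),
        glueL2_ae (fun t : M.Cell => evv (P t - B t)) (fun t => continuous_evv _) t] with x h1 h2
      rw [h1, h2]
      rfl
  · exact mem_globalBubble.2 fun t => ⟨_, hBm t, glueL2_ae _ _ t⟩
  · refine Lp.ext (ae_domain fun t => ?_)
    filter_upwards [hP t, ae_vol_of_ae (Lp.coeFn_add (glueL2 (fun t : M.Cell => evv (P t - B t))
        fun t => continuous_evv _) (glueL2 (fun t : M.Cell => evv (B t)) fun t => continuous_evv _)),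
      glueL2_ae (fun t : M.Cell => evv (P t - B t)) (fun t => continuous_evv _) t,
      glueL2_ae (fun t : M.Cell => evv (B t)) (fun t => continuous_evv _) t] with x h1 h2 h3 h4
    rw [h2, Pi.add_apply, h3, h4, h1, evv_sub, sub_add_cancel]

/-- The weak curl is assembled from weak partial derivatives by the classical formula; `g j i` is
`∂_i w_j`. -/
theorem mem_Hcurl_of_comp_mem_H1 {w : L2v M.domain} (h : ∀ i, comp i w ∈ H1 M.domain) :
    w ∈ Hcurl M.domain := by
  choose g hg using h
  have hmem : MemLp (fun x => (!₂[g 2 1 x - g 1 2 x, g 0 2 x - g 2 0 x, g 1 0 x - g 0 1 x] : E3)) 2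
      (volume.restrict M.domain) := by
    rw [memLp_piLp_iff]
    intro i
    fin_cases i
    · exact (Lp.memLp (g 2 1)).sub (Lp.memLp (g 1 2))
    · exact (Lp.memLp (g 0 2)).sub (Lp.memLp (g 2 0))
    · exact (Lp.memLp (g 1 0)).sub (Lp.memLp (g 0 1))
  refine ⟨hmem.toLp _, fun φ hφ => ?_⟩
  have hφc : ∀ k, IsTest M.domain fun y => φ y k := fun k => by
    refine ⟨contDiff_coord hφ.1 k, hφ.2.1.comp_left (g := fun z : E3 => z k) rfl, ?_⟩
    refine subset_trans (closure_mono fun x hx => ?_) hφ.2.2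
    rw [Function.mem_support] at hx ⊢
    intro h
    exact hx (by rw [h]; rfl)
  have i1 : ∀ (s : L2s M.domain) i k, Integrable (fun x => s x * pd i (fun y => φ y k) x)
      (volume.restrict M.domain) := fun s i k =>
    integrable_mul_test s (continuous_pd (hφc k).1 i) (compactSupport_pd (hφc k).2.1 i)
  have i2 : ∀ (s : L2s M.domain) k, Integrable (fun x => s x * φ x k)
      (volume.restrict M.domain) := fun s k =>
    integrable_mul_test s (hφc k).1.continuous (hφc k).2.1
  have hI := fun j i k => hg j i _ (hφc k)
  have key : ∀ {a b c d e f : E3 → ℝ}, Integrable a (volume.restrict M.domain) →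
      Integrable b (volume.restrict M.domain) → Integrable c (volume.restrict M.domain) →
      Integrable d (volume.restrict M.domain) → Integrable e (volume.restrict M.domain) →
      Integrable f (volume.restrict M.domain) →
      ∫ x in M.domain, (a x - b x + (c x - d x)) + (e x - f x) =
        (∫ x in M.domain, a x) - (∫ x in M.domain, b x) +
          ((∫ x in M.domain, c x) - ∫ x in M.domain, d x) +
          ((∫ x in M.domain, e x) - ∫ x in M.domain, f x) := by
    intro a b c d e f ha hb hc hd he hf
    have h := integral_add' ((ha.sub hb).add (hc.sub hd)) (he.sub hf)
    rwa [integral_add' (ha.sub hb) (hc.sub hd), integral_sub' ha hb, integral_sub' hc hd,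
      integral_sub' he hf] at h
  calc ∫ x in M.domain, inner ℝ (w x) (curl φ x)
      = ∫ x in M.domain, ((comp 0 w x * pd 1 (fun y => φ y 2) x - comp 0 w x * pd 2 (fun y => φ y 1) x)
        + (comp 1 w x * pd 2 (fun y => φ y 0) x - comp 1 w x * pd 0 (fun y => φ y 2) x))
        + (comp 2 w x * pd 0 (fun y => φ y 1) x - comp 2 w x * pd 1 (fun y => φ y 0) x) := by
        refine integral_congr_ae ?_
        filter_upwards [comp_ae 0 w, comp_ae 1 w, comp_ae 2 w] with x h0 h1 h2
        rw [h0, h1, h2]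
        simp [curl, PiLp.inner_apply, Fin.sum_univ_three]
        ring
    _ = ∫ x in M.domain, ((g 2 1 x * φ x 0 - g 1 2 x * φ x 0)
        + (g 0 2 x * φ x 1 - g 2 0 x * φ x 1)) + (g 1 0 x * φ x 2 - g 0 1 x * φ x 2) := by
        rw [key (i1 _ _ _) (i1 _ _ _) (i1 _ _ _) (i1 _ _ _) (i1 _ _ _) (i1 _ _ _),
          key (i2 _ _) (i2 _ _) (i2 _ _) (i2 _ _) (i2 _ _) (i2 _ _)]
        simp only [hI]
        ring
    _ = ∫ x in M.domain, inner ℝ ((hmem.toLp _ : L2v M.domain) x) (φ x) := by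
        refine integral_congr_ae ?_
        filter_upwards [hmem.coeFn_toLp] with x hx
        rw [hx]
        simp [PiLp.inner_apply, Fin.sum_univ_three]
        ring

/-- Continuous functions equal almost everywhere on an open set agree on it, and the cell is the
closure of its interior. This makes the values on edges meaningful for Hermite functions, which are
given only as classes in `L²`. -/
theorem eqOn_body_of_ae {t : M.Cell} {f : E3 → ℝ} (hf : ContinuousOn f M.closedDomain)
    {q : Poly} (h : f =ᵐ[t.vol] ev q) : Set.EqOn f (ev q) t.body := by
  rw [t.vol_eq] at h
  have h1 : Set.EqOn f (ev q) (interior t.body) :=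
    Measure.eqOn_open_of_ae_eq h isOpen_interior
      (hf.mono (interior_subset.trans t.body_subset)) (continuous_ev q).continuousOn
  refine h1.of_subset_closure (hf.mono t.body_subset) (continuous_ev q).continuousOn
    interior_subset ?_
  rw [t.closure_interior]

theorem vectorHermite_le (p : ℕ) : M.vectorHermite p ≤ M.P2Λ1 p := by
  intro w hw
  rw [mem_vectorHermite] at hw
  choose hH1 hf P hdeg hP hvert using hw
  choose f hfc hfe using hf
  have heq : ∀ i (t : M.Cell), Set.EqOn (f i) (ev (P i t)) t.body := fun i t =>
    eqOn_body_of_ae (hfc i) (by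
      have : comp i w =ᵐ[t.vol] f i := ae_vol_of_ae (hfe i)
      exact this.symm.trans (hP i t))
  refine ⟨mem_Hcurl_of_comp_mem_H1 hH1, fun t i => P i t, fun t i => hdeg i t, fun t => ?_,
    fun t t' x hx hx' i => hvert i t t' x hx hx', fun t t' e he he' _ x hx => ?_⟩
  · have h1 : ∀ᵐ x ∂t.vol, ∀ i, comp i w x = w x i :=
      ae_all_iff.2 fun i => ae_vol_of_ae (comp_ae i w)
    have h2 : ∀ᵐ x ∂t.vol, ∀ i, comp i w x = ev (P i t) x := ae_all_iff.2 fun i => hP i t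
    filter_upwards [h1, h2] with x h1 h2
    ext i
    rw [← h1, h2]
    rfl
  · ext i
    have hx1 : x ∈ t.body := convexHull_mono (by exact_mod_cast he) hx
    have hx2 : x ∈ t'.body := convexHull_mono (by exact_mod_cast he') hx
    exact (heq i t hx1).symm.trans (heq i t' hx2)

theorem setIntegral_domain_eq_sum {h : E3 → ℝ} (hi : Integrable h (volume.restrict M.domain)) :
    ∫ x in M.domain, h x = ∑ t : M.Cell, ∫ x, h x ∂t.vol := by
  have hU : volume.restrict M.domain = volume.restrict (⋃ t : M.Cell, interior t.body) := by
    refine Measure.restrict_congr_set (EventuallyLE.antisymm ?_ ?_)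
    · filter_upwards [ae_interior (M := M)] with x hx hd
      exact Set.mem_iUnion.2 (hx (interior_subset hd))
    · exact (Set.iUnion_subset fun t : M.Cell => t.interior_subset_domain).eventuallyLE
  rw [hU, integral_iUnion_fintype]
  · exact Finset.sum_congr rfl fun t _ => by rw [t.vol_eq]
  · exact fun t => isOpen_interior.measurableSet
  · intro t t' hne
    exact Set.disjoint_left.2 fun x hx hx' => hne (Cell.eq_of_mem_interior t t' hx (interior_subset hx'))
  · intro t
    rw [IntegrableOn, ← t.vol_eq]
    exact hi.restrict

/-- The weak curl is the cellwise one, because integration by parts in a single cell already has no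
boundary term. At vertices and edges both sides of each condition are zero. -/
theorem globalBubble_le (p : ℕ) : M.globalBubble p ≤ M.P2Λ1 p := by
  intro w hw
  rw [mem_globalBubble] at hw
  choose f hf hwf using hw
  choose B hB hfB using fun t : M.Cell => t.exists_isBubble (hf t)
  have hwB : ∀ t : M.Cell, w =ᵐ[t.vol] evv (B t) := fun t => hfB t ▸ hwf t
  choose C hC using fun t => (hB t).curl
  refine ⟨⟨glueL2 (fun t : M.Cell => evv (C t)) fun t => continuous_evv _, fun φ hφ => ?_⟩, B,
    fun t i => (hB t).degree i, hwB, fun t t' x hx hx' i => ?_, fun t t' e he he' hc x hx => ?_⟩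
  · rw [setIntegral_domain_eq_sum (integrable_inner_test w (continuous_curl hφ.1)
      (compactSupport_curl hφ.2.1)),
      setIntegral_domain_eq_sum (integrable_inner_test _ hφ.1.continuous hφ.2.1)]
    refine Finset.sum_congr rfl fun t _ => ?_
    have e1 : ∫ x, inner ℝ (w x) (curl φ x) ∂t.vol = ∫ x, inner ℝ (evv (B t) x) (curl φ x) ∂t.vol := by
      refine integral_congr_ae ?_
      filter_upwards [hwB t] with x hx
      rw [hx]
    rw [e1, hC t φ hφ.1 hφ.2.1]
    refine integral_congr_ae ?_
    filter_upwards [glueL2_ae (fun t : M.Cell => evv (C t)) (fun t => continuous_evv _) t] with x hx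
    rw [hx]
  · have h1 := (hB t).vertex i x hx
    have h2 := (hB t').vertex i x hx'
    exact ⟨h1.1.trans h2.1.symm, fun j => (h1.2 j).trans (h2.2 j).symm⟩
  · rw [(hB t).eq_zero_of_mem_convexHull he hc.le hx, (hB t').eq_zero_of_mem_convexHull he' hc.le hx]

/-- Bubbles of different cells are independent, so a local bubble extended by zero to the other
cells is a global one. -/
theorem map_restr_globalBubble (p : ℕ) (t : M.Cell) :
    (M.globalBubble p).map t.restr = t.bubbleL2 p := by
  classical
  apply le_antisymm
  · rw [Submodule.map_le_iff_le_comap]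
    exact iInf_le _ t
  · rintro g ⟨f, hf, hg⟩
    obtain ⟨B, hB, rfl⟩ := t.exists_isBubble hf
    let Q : M.Cell → E3 → E3 := fun t' => if t' = t then evv B else 0
    have hQ : ∀ t', Continuous (Q t') := fun t' => by
      by_cases h : t' = t
      · simp only [Q, if_pos h]; exact continuous_evv B
      · simp only [Q, if_neg h]; exact continuous_zero
    refine ⟨glueL2 Q hQ, mem_globalBubble.2 fun t' => ?_, ?_⟩
    · by_cases h : t' = t
      · subst h
        refine ⟨evv B, hf, (glueL2_ae Q hQ t').trans ?_⟩
        simp only [Q, if_pos]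
        exact EventuallyEq.rfl
      · refine ⟨0, zero_mem _, (glueL2_ae Q hQ t').trans ?_⟩
        simp only [Q, if_neg h]
        exact EventuallyEq.rfl
    · refine Lp.ext ?_
      have h1 : t.restr (glueL2 Q hQ) =ᵐ[t.vol] glueL2 Q hQ := LpToLpRestrictCLM_coeFn ℝ t.body _
      refine (h1.trans (glueL2_ae Q hQ t)).trans ?_
      simp only [Q, if_pos]
      exact hg.symm

end TetMesh

end

theorem mainTheorem7 (M : TetMesh) (p : ℕ) :
    M.P2Λ1 p = M.vectorHermite p ⊔ M.globalBubble p ∧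
      ∀ t : M.Cell, (M.globalBubble p).map t.restr = t.bubbleL2 p :=
  ⟨le_antisymm (TetMesh.P2Λ1_le p) (sup_le (TetMesh.vectorHermite_le p) (TetMesh.globalBubble_le p)),
    fun t => TetMesh.map_restr_globalBubble p t⟩
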